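/- Let $\mathcal X,\mathcal U$ be real Hilbert spaces, $f:\mathcal X\to\mathbb R$ convex and differentiable with $L$-Lipschitz gradient, $L>0$, let $K:\mathcal X\to\mathcal U$ be a nonzero bounded linear operator, $b\in\mathrm{ran}(K)$, and consider the problem $$\min_{x\in\mathcal X} f(x)\quad\text{s.t. } Kx=b. \qquad (P)$$ Let $h$ be the indicator function of $\{b\}$ and $h^*$ its conjugate, so $h^*(u)=\langle u,b\rangle$. The dual problem is $\min_{u\in\mathcal U} f^*(-K^*u)+h^*(u)$, the Lagrangian is $\mathcal L(x,u)=f(x)+\langle Kx,u\rangle-h^*(u)$, and for points $(x^\star,u^\star)$ put $\mathcal G_{x^\star,u^\star}(x,u)=\mathcal L(x,u^\star)-\mathcal L(x^\star,u)$. A pair $(x,u)$ is a saddle point if $\nabla f(x)+K^*u=0$ and $Kx\in\partial h^*(u)$. Suppose $$\lambda:=\lambda^+_{\min}(KK^*):=\inf_{u\in\overline{\mathrm{ran}(K)},\,u\ne0}\frac{\|K^*u\|^2}{\|u\|^2}>0,$$ and let $(x^\star,u^\star)$ satisfy $\nabla f(x^\star)+K^*u^\star=0$, $u^\star\in\mathrm{ran}(K)$,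 $Kx^\star=b$. Let $0<\gamma\le\frac1{2L}$, $\nu\in(0,1]$, $\tau=\frac{\nu}{\gamma\|K\|^2}$, $a_0=a_1=1$, and for $t\ge1$ $$a_{t+1}=\min\left(a_t\sqrt{1+\tfrac{\nu\lambda}{4\|K\|^2}},\ \sqrt{a_t^2+a_t\tfrac{\nu\lambda}{4\gamma L\|K\|^2}},\ \tfrac{1+\sqrt{1+4a_t^2}}2\right).$$ Let $x^0=z^0\in\mathcal X$, $u^0=v^0\in\mathrm{ran}(K)$ and, for $t\ge0$ (the APAPC algorithm with $g=0$), $$\begin{aligned} y^t&=(1-\tfrac1{a_{t+1}})x^t+\tfrac1{a_{t+1}}z^t, & \hat z^t&=z^t-a_{t+1}\gamma\nabla f(y^t)-a_{t+1}\gamma K^*v^t,\\ v^{t+1}&=\mathrm{prox}_{\frac{\tau}{a_{t+1}}h^*}\big(v^t+\tfrac{\tau}{a_{t+1}}K\hat z^t\big), & z^{t+1}&=z^t-a_{t+1}\gamma\nabla f(y^t)-a_{t+1}\gamma K^*v^{t+1},\\ x^{t+1}&=(1-\tfrac1{a_{t+1}})x^t+\tfrac1{a_{t+1}}z^{t+1},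 & u^{t+1}&=(1-\tfrac1{a_{t+1}})u^t+\tfrac1{a_{t+1}}v^{t+1}, \end{aligned}$$ and let $\tilde\nabla h^*(v^{t+1})$ be defined by $v^{t+1}+\frac{\tau}{a_{t+1}}\tilde\nabla h^*(v^{t+1})=v^t+\frac{\tau}{a_{t+1}}K\hat z^t$. Define $$\mathcal E^t_{x^\star}=\tfrac1{2\gamma}\|z^t-x^\star\|^2+\tfrac{2a_t^2+\min(\frac12,\frac1{2a_t\gamma L})\gamma\tau a_t^2\lambda}{4\tau}\|v^t-u^\star\|^2-\tfrac{a_t^2\gamma}2\|K^*(v^t-u^\star)\|^2+a_t^2\,\mathcal G_{x^\star,u^\star}(x^t,u^t)+\tfrac{a_t\tau}2\|Kx^t-b\|^2 .$$ Then $(\mathcal E^t_{x^\star})_{t\ge0}$ is nonincreasing, $\mathcal G_{x^\star,u^\star}(x^t,u^t)=\mathcal O(1/t^2)$, $a_t=\Theta(t)$, $\|v^t-u^\star\|^2=\mathcal O(1/t)$, for every $t\ge 1$ the vector $\tilde\nabla h^*(v^t)$ belongs to $\partial h^*(v^t)$ and equals $b$, and $\|Kz^t-b\|\to0$. Moreover: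 (i) $a_t\to\infty$ and $\sum_{t\ge1}1/a_t=\infty$; (ii) $u^\star$ is the unique solution of the dual problem in $\mathrm{ran}(K)$, and $\|v^t-u^\star\|\to0$; (iii) $(z^t)_{t\ge0}$ is bounded; (iv) $\mathcal G_{x',u'}(x^t,u^t)\to0$ for every saddle point $(x',u')$; (v) $\|Kz^t-\tilde\nabla h^*(v^t)\|\to0$; (vi) there is a sequence $\mathcal R^t\ge0$, independent of the saddle point, such that for every saddle point $(x',u')$ the sequence $\frac1{2\gamma}\|z^t-x'\|^2+a_t^2\,\mathcal G_{x',u'}(x^t,u^t)+\mathcal R^t$ is nonincreasing in $t\ge0$; (vii) $Kx_1=Kx_2$ for any two saddle points $(x_1,u')$ and $(x_2,u')$. Consequently, there is a solution $x^\infty$ of $(P)$ such that $(x^t)_{t\ge0}$ and $(y^t)_{t\ge0}$ both converge weakly to $x^\infty$. -/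

import Mathlib

open Filter Topology Asymptotics

noncomputable section

namespace APAPC

variable {X U : Type*} [NormedAddCommGroup X] [InnerProductSpace ℝ X]
  [NormedAddCommGroup U] [InnerProductSpace ℝ U]

/-- The convex conjugate `φ*(u) = sup_w (⟪w, u⟫ - φ w)` of an extended-real-valued function. -/
def conjugate (φ : U → EReal) (u : U) : EReal :=
  ⨆ w : U, ((inner ℝ w u : ℝ) : EReal) - φ w

/-- The indicator function of the singleton `{b}`: `0` at `b`, `+∞` elsewhere. -/
def indicatorPoint (b : U) (w : U) : EReal :=
  open Classical in if w = b then 0 else ⊤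

/-- The subdifferential `∂φ(u)` of a proper function `φ`. -/
def subdifferential (φ : U → EReal) (u : U) : Set U :=
  {w | ∀ v : U, φ u + ((inner ℝ (v - u) w : ℝ) : EReal) ≤ φ v}

/-- `p = prox_φ(x)`: the point `p` minimizes `q ↦ φ q + ‖q - x‖² / 2`. -/
def IsProx (φ : U → EReal) (x p : U) : Prop :=
  ∀ q : U, φ p + ((1 / 2 * ‖p - x‖ ^ 2 : ℝ) : EReal) ≤ φ q + ((1 / 2 * ‖q - x‖ ^ 2 : ℝ) : EReal)

/-- The Lagrangian `(f + (μ/2)‖·‖²)(x) + ⟪K x, u⟫ - h*(u)`, where `hc` stands for `h*`. -/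
def lagrangian (f : X → ℝ) (μ : ℝ) (K : X →L[ℝ] U) (hc : U → EReal) (x : X) (u : U) : EReal :=
  ((f x + μ / 2 * ‖x‖ ^ 2 + inner ℝ (K x) u : ℝ) : EReal) - hc u

/-- The Lagrangian gap `𝓛(x, us) - 𝓛(xs, u)` as a real number. When `hc` is the conjugate of the
indicator function of a point, the difference is finite (`coe_gap` below). -/
def gap (f : X → ℝ) (μ : ℝ) (K : X →L[ℝ] U) (hc : U → EReal) (xs : X) (us : U)
    (x : X) (u : U) : ℝ :=
  (lagrangian f μ K hc x us - lagrangian f μ K hc xs u).toReal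

theorem conjugate_indicatorPoint (b u : U) :
    conjugate (indicatorPoint b) u = ((inner ℝ u b : ℝ) : EReal) := by
  unfold conjugate indicatorPoint
  apply le_antisymm
  · refine iSup_le fun w => ?_
    by_cases h : w = b
    · subst h
      simp [real_inner_comm]
    · simp [h]
  · refine le_trans ?_ (le_iSup _ b)
    simp [real_inner_comm]

theorem coe_gap (f : X → ℝ) (μ : ℝ) (K : X →L[ℝ] U) (b : U) (xs : X) (us : U) (x : X) (u : U) :
    ((gap f μ K (conjugate (indicatorPoint b)) xs us x u : ℝ) : EReal) =
      lagrangian f μ K (conjugate (indicatorPoint b)) x us -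
        lagrangian f μ K (conjugate (indicatorPoint b)) xs u := by
  simp only [gap, lagrangian, conjugate_indicatorPoint]
  norm_cast

/-- The primal problem: `x` minimizes `f + (μ/2)‖·‖²` subject to `K x = b`. -/
def IsPrimalSolution (f : X → ℝ) (μ : ℝ) (K : X →L[ℝ] U) (b : U) (x : X) : Prop :=
  K x = b ∧ ∀ x' : X, K x' = b → f x + μ / 2 * ‖x‖ ^ 2 ≤ f x' + μ / 2 * ‖x'‖ ^ 2

variable [CompleteSpace X] [CompleteSpace U]

/-- The dual objective `(f + (μ/2)‖·‖²)*(-K* u) + h*(u)`. -/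
def dualObjective (f : X → ℝ) (μ : ℝ) (K : X →L[ℝ] U) (hc : U → EReal) (u : U) : EReal :=
  conjugate (fun x : X => ((f x + μ / 2 * ‖x‖ ^ 2 : ℝ) : EReal)) (-(K.adjoint u)) + hc u

/-- `u` minimizes the dual objective over the whole space. -/
def IsDualSolution (f : X → ℝ) (μ : ℝ) (K : X →L[ℝ] U) (hc : U → EReal) (u : U) : Prop :=
  ∀ u' : U, dualObjective f μ K hc u ≤ dualObjective f μ K hc u'

/-- Saddle points of the Lagrangian, through the optimality conditions
`0 = ∇f(x) + μ x + K* u` and `K x ∈ ∂h*(u)`. -/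
def IsSaddlePoint (f : X → ℝ) (μ : ℝ) (K : X →L[ℝ] U) (hc : U → EReal) (x : X) (u : U) : Prop :=
  gradient f x + μ • x + K.adjoint u = 0 ∧ K x ∈ subdifferential hc u

/-- The optimality conditions of the linearly constrained problem, with the dual
variable taken in the range of `K`. -/
def IsConstrainedSolution (f : X → ℝ) (μ : ℝ) (K : X →L[ℝ] U) (b : U) (x : X) (u : U) : Prop :=
  gradient f x + μ • x + K.adjoint u = 0 ∧ u ∈ Set.range K ∧ K x = b

/-- `λ⁺_min(K K*)`: the infimum of `‖K* u‖² / ‖u‖²` over nonzero `u` in the closure of the range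
of `K`. -/
def lambdaMinPos (K : X →L[ℝ] U) : ℝ :=
  sInf {r : ℝ | ∃ u ∈ closure (Set.range K), u ≠ 0 ∧ r = ‖K.adjoint u‖ ^ 2 / ‖u‖ ^ 2}

/-- The sequences `x, y, z, zh, u, v` are the iterates of the Accelerated Proximal Alternating
Predictor-Corrector algorithm for `f + (μ/2)‖·‖² + h ∘ K`, with stepsizes `γ, τ` and parameters
`a`; here `hc` stands for `h*` and `zh` for the predicted points `ẑ`. -/
structure IsAPAPC (f : X → ℝ) (μ : ℝ) (K : X →L[ℝ] U) (hc : U → EReal) (γ τ : ℝ) (a : ℕ → ℝ)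
    (x y z zh : ℕ → X) (u v : ℕ → U) : Prop where
  init_primal : x 0 = z 0
  init_dual : u 0 = v 0
  y_step : ∀ t, y t = (1 - 1 / a (t + 1)) • x t + (1 / a (t + 1)) • z t
  predict : ∀ t, zh t = (1 + a (t + 1) * γ * μ)⁻¹ •
    (z t - (a (t + 1) * γ) • gradient f (y t) - (a (t + 1) * γ) • K.adjoint (v t))
  dual_step : ∀ t, IsProx (fun w => ((τ / a (t + 1) : ℝ) : EReal) * hc w)
    (v t + (τ / a (t + 1)) • K (zh t)) (v (t + 1))
  correct : ∀ t, z (t + 1) = (1 + a (t + 1) * γ * μ)⁻¹ •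
    (z t - (a (t + 1) * γ) • gradient f (y t) - (a (t + 1) * γ) • K.adjoint (v (t + 1)))
  x_step : ∀ t, x (t + 1) = (1 - 1 / a (t + 1)) • x t + (1 / a (t + 1)) • z (t + 1)
  u_step : ∀ t, u (t + 1) = (1 - 1 / a (t + 1)) • u t + (1 / a (t + 1)) • v (t + 1)

/-- `s (t + 1)` is the subgradient of `h*` at `v (t + 1)` selected by the proximal step:
`v (t + 1) + (τ / a (t + 1)) s (t + 1) = v t + (τ / a (t + 1)) K (zh t)`. -/
def IsProxSubgradient (K : X →L[ℝ] U) (τ : ℝ) (a : ℕ → ℝ) (zh : ℕ → X) (v s : ℕ → U) : Prop :=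
  ∀ t, v (t + 1) + (τ / a (t + 1)) • s (t + 1) = v t + (τ / a (t + 1)) • K (zh t)

/-- The Lyapunov function of the linearly constrained problem for `μ = 0`. -/
def lyapunov (f : X → ℝ) (L : ℝ) (K : X →L[ℝ] U) (hc : U → EReal) (b : U) (γ τ : ℝ) (a : ℕ → ℝ)
    (x z : ℕ → X) (u v : ℕ → U) (xs : X) (us : U) (t : ℕ) : ℝ :=
  1 / (2 * γ) * ‖z t - xs‖ ^ 2
    + (2 * a t ^ 2 + min (1 / 2) (1 / (2 * a t * γ * L)) * γ * τ * a t ^ 2 * lambdaMinPos K)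
        / (4 * τ) * ‖v t - us‖ ^ 2
    - a t ^ 2 * γ / 2 * ‖K.adjoint (v t - us)‖ ^ 2
    + a t ^ 2 * gap f 0 K hc xs us (x t) (u t)
    + a t * τ / 2 * ‖K (x t) - b‖ ^ 2

end APAPC

end

open APAPC

/-!
The constraint makes `h* = ⟪·, b⟫`, so the proximal step is an explicit gradient step, every
selected subgradient is `b`, and the Lagrangian gap at a saddle point `(p, w)` is the Bregman
divergence of `f` from `p`. The latter is the same function for all saddle points
(`gradient_eq_and_bregman_eq`), because co-coercivity of the gradient forces `∇f` to agree at all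
of them.

One step with parameter `A = a (t + 1)` is analysed in `energy_step`. It adds up the accelerated
descent inequality for `f` (`sq_mul_bregman_le`), the polarization identity of the primal step, and
that of the dual step in the form `P = τ⁻¹ - γ K K*`. Two nonnegative remainders are kept. The
first is `‖P^(1/2) (v' - v)‖²`, which controls `‖K z' - b‖²` since `A P (v' - v) = K z' - b` and
`P ≤ τ⁻¹`. The second is a combination of `‖∇f y - ∇f p‖²` and `‖z' - z‖²`, which controls
`‖K* (v' - us)‖²` (`young_residual`) and hence, through `λ⁺_min(K K*)`, the squared dual error
itself. The recursion for `a` is what lets the resulting gain pay for the growth of the weights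
from `a t` to `a (t + 1)`, and still allows `a` to grow linearly. Thus the Lyapunov function
decreases, and since it is coercive (`ConstrainedRun.le_dualEnergy`) all rates follow; the
remainder `‖K z - b‖²` tends to zero because it is bounded by the decrease of a nonnegative
sequence.

Weak convergence is an argument of Opial type. The Lyapunov functions of two solutions `p`, `p'`
with the same `us` differ by a constant plus a multiple of `⟪z t, p - p'⟫`, so these inner products
converge. As `x` is an average of `z` with non-summable weights `1 / a`, the numbers
`⟪x t, p - p'⟫` converge too (`tendsto_of_averaging`). Weak cluster points of `x` are solutions, by
weak lower semicontinuity of the Bregman divergence, and two of them must then coincide. Weak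
compactness is used along ultrafilters, which avoids extracting subsequences. Finally
`x (t + 1) - y t` tends to zero in norm.
-/

namespace APAPC

/-! ### Convex functions with Lipschitz gradient -/

section Smooth

variable {X : Type*} [NormedAddCommGroup X] [InnerProductSpace ℝ X] [CompleteSpace X] {f : X → ℝ}

theorem hasDerivAt_comp_line (hf : Differentiable ℝ f) (p d : X) (r : ℝ) :
    HasDerivAt (fun r : ℝ => f (p + r • d)) (inner ℝ (gradient f (p + r • d)) d) r := by
  have h1 : HasDerivAt (fun r : ℝ => p + r • d) d r := by
    simpa using ((hasDerivAt_id r).smul_const d).const_add p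
  have h2 := (hf (p + r • d)).hasGradientAt.hasFDerivAt.comp_hasDerivAt r h1
  simpa [Function.comp_def] using h2

theorem add_inner_gradient_le (hc : ConvexOn ℝ Set.univ f) (hf : Differentiable ℝ f)
    (p q : X) : f p + inner ℝ (gradient f p) (q - p) ≤ f q := by
  have hconv : ConvexOn ℝ Set.univ (fun r : ℝ => f (p + r • (q - p))) := by
    have := hc.comp_affineMap (AffineMap.lineMap p q : ℝ →ᵃ[ℝ] X)
    simpa [Function.comp_def, AffineMap.lineMap_apply, add_comm] using this
  have hd := hasDerivAt_comp_line hf p (q - p) 0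
  have := hconv.le_slope_of_hasDerivAt (Set.mem_univ 0) (Set.mem_univ 1) zero_lt_one hd
  simp [slope_def_field, -inner_gradient_left] at this
  linarith

/-- The descent lemma: a function with `L`-Lipschitz gradient lies below its quadratic upper
model. -/
theorem le_add_inner_gradient_add_sq (hf : Differentiable ℝ f) {L : ℝ}
    (hL : ∀ p q : X, ‖gradient f p - gradient f q‖ ≤ L * ‖p - q‖) (p q : X) :
    f q ≤ f p + inner ℝ (gradient f p) (q - p) + L / 2 * ‖q - p‖ ^ 2 := by
  set d := q - p with hd
  let φ : ℝ → ℝ := fun r => f (p + r • d) - r * inner ℝ (gradient f p) d - L / 2 * ‖d‖ ^ 2 * r ^ 2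
  have hφ : ∀ r, HasDerivAt φ (inner ℝ (gradient f (p + r • d)) d - inner ℝ (gradient f p) d
      - L * ‖d‖ ^ 2 * r) r := by
    intro r
    have h := ((hasDerivAt_comp_line hf p d r).sub
      ((hasDerivAt_id r).mul_const (inner ℝ (gradient f p) d))).sub
      ((hasDerivAt_pow 2 r).const_mul (L / 2 * ‖d‖ ^ 2))
    refine h.congr_deriv ?_
    simp [-inner_gradient_left]
    ring
  have hanti : AntitoneOn φ (Set.Icc 0 1) := by
    apply antitoneOn_of_deriv_nonpos (convex_Icc 0 1)
    · exact fun r _ => (hφ r).continuousAt.continuousWithinAt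
    · exact fun r _ => (hφ r).differentiableAt.differentiableWithinAt
    · intro r hr
      rw [interior_Icc] at hr
      rw [(hφ r).deriv, ← inner_sub_left]
      have h1 := real_inner_le_norm (gradient f (p + r • d) - gradient f p) d
      have h2 := hL (p + r • d) p
      rw [add_sub_cancel_left, norm_smul, Real.norm_of_nonneg hr.1.le] at h2
      have h3 := mul_le_mul_of_nonneg_right h2 (norm_nonneg d)
      nlinarith
  have := hanti (Set.left_mem_Icc.2 zero_le_one) (Set.right_mem_Icc.2 zero_le_one) zero_le_one
  have hq : p + d = q := by rw [hd]; abel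
  simp [φ, hq, -inner_gradient_left] at this
  linarith

/-- Convexity sharpened by smoothness: the gradient inequality with the squared gradient
difference as a remainder. -/
theorem add_inner_gradient_add_sq_le (hc : ConvexOn ℝ Set.univ f)
    (hf : Differentiable ℝ f) {L : ℝ} (hL0 : 0 < L)
    (hL : ∀ p q : X, ‖gradient f p - gradient f q‖ ≤ L * ‖p - q‖) (p q : X) :
    f p + inner ℝ (gradient f p) (q - p) + 1 / (2 * L) * ‖gradient f q - gradient f p‖ ^ 2
      ≤ f q := by
  set g := gradient f q - gradient f p with hg
  -- compare both models at a gradient step from `q` for `f - ⟪∇f p, ·⟫`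
  have h1 := add_inner_gradient_le hc hf p (q - (1 / L) • g)
  have h2 := le_add_inner_gradient_add_sq hf hL q (q - (1 / L) • g)
  have e1 : q - (1 / L) • g - p = (q - p) - (1 / L) • g := by abel
  have e2 : q - (1 / L) • g - q = -((1 / L) • g) := by abel
  rw [e1, inner_sub_right, inner_smul_right] at h1
  rw [e2, inner_neg_right, inner_smul_right, norm_neg, norm_smul, Real.norm_of_nonneg
    (by positivity)] at h2
  have e3 : inner ℝ (gradient f q) g = inner ℝ (gradient f p) g + ‖g‖ ^ 2 := by
    rw [← real_inner_self_eq_norm_sq, ← inner_add_left, hg]; congr 1; abel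
  rw [e3] at h2
  have e4 : L / 2 * (1 / L * ‖g‖) ^ 2 = 1 / (2 * L) * ‖g‖ ^ 2 := by field_simp
  have e5 : 1 / L * ‖g‖ ^ 2 = 2 * (1 / (2 * L) * ‖g‖ ^ 2) := by field_simp
  linarith

end Smooth

/-! ### Weighted averages and weak convergence -/

/-- Relaxed averages with non-summable weights inherit the limit of the averaged sequence. -/
theorem tendsto_of_averaging {c e θ : ℕ → ℝ} {l : ℝ} (hθ0 : ∀ t, 0 ≤ θ t) (hθ1 : ∀ t, θ t ≤ 1)
    (hθ : Tendsto (fun n => ∑ t ∈ Finset.range n, θ t) atTop atTop)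
    (hc : ∀ t, c (t + 1) = (1 - θ t) * c t + θ t * e t) (he : Tendsto e atTop (𝓝 l)) :
    Tendsto c atTop (𝓝 l) := by
  rw [Metric.tendsto_atTop] at he ⊢
  intro ε hε
  obtain ⟨N, hN⟩ := he (ε / 2) (half_pos hε)
  have hN' : ∀ t ≥ N, |e t - l| ≤ ε / 2 := fun t ht => (hN t ht).le
  set B := |c N - l| with hB
  -- the excess over `ε / 2` is damped by the factors `1 - θ ≤ exp (-θ)`
  have key : ∀ n, |c (N + n) - l| ≤
      ε / 2 + B * Real.exp (-(∑ t ∈ Finset.range n, θ (N + t))) := by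
    intro n
    induction n with
    | zero => simp [hB]; positivity
    | succ n ih =>
      have h1 : c (N + (n + 1)) - l = (1 - θ (N + n)) * (c (N + n) - l)
          + θ (N + n) * (e (N + n) - l) := by rw [← add_assoc, hc]; ring
      have h0 : 0 ≤ 1 - θ (N + n) := sub_nonneg.2 (hθ1 _)
      have h2 : |c (N + (n + 1)) - l| ≤ (1 - θ (N + n)) * |c (N + n) - l|
          + θ (N + n) * |e (N + n) - l| := by
        rw [h1]
        refine (abs_add_le _ _).trans ?_
        rw [abs_mul, abs_mul, abs_of_nonneg h0, abs_of_nonneg (hθ0 _)]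
      have h3 := mul_le_mul_of_nonneg_left (hN' (N + n) (Nat.le_add_right _ _)) (hθ0 (N + n))
      have h4 := mul_le_mul_of_nonneg_left ih h0
      have h5 : 1 - θ (N + n) ≤ Real.exp (-θ (N + n)) := Real.one_sub_le_exp_neg _
      have h6 : 0 ≤ B * Real.exp (-(∑ t ∈ Finset.range n, θ (N + t))) := by positivity
      rw [Finset.sum_range_succ, neg_add, Real.exp_add]
      nlinarith [mul_le_mul_of_nonneg_right h5 h6]
  have hsum : Tendsto (fun n => ∑ t ∈ Finset.range n, θ (N + t)) atTop atTop := by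
    have h1 := (tendsto_add_atTop_iff_nat N).2 hθ
    have h2 := tendsto_atTop_add_const_right atTop (-∑ t ∈ Finset.range N, θ t) h1
    refine h2.congr fun n => ?_
    rw [add_comm n N, Finset.sum_range_add]
    ring
  have hlim : Tendsto (fun n => B * Real.exp (-(∑ t ∈ Finset.range n, θ (N + t)))) atTop
      (𝓝 0) := by
    simpa using (Real.tendsto_exp_neg_atTop_nhds_zero.comp hsum).const_mul B
  obtain ⟨M, hM⟩ := eventually_atTop.1 (hlim.eventually_lt_const (half_pos hε))
  refine ⟨N + M, fun t ht => ?_⟩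
  obtain ⟨n, rfl⟩ := Nat.exists_eq_add_of_le (le_trans (Nat.le_add_right N M) ht)
  have := key n
  have := hM n (by omega)
  rw [Real.dist_eq]
  linarith

section Weak

variable {X : Type*} [NormedAddCommGroup X] [InnerProductSpace ℝ X] [CompleteSpace X]

theorem tendsto_toWeakSpace_iff {ι : Type*} {l : Filter ι} {x : ι → X} {p : X} :
    Tendsto (fun i => toWeakSpace ℝ X (x i)) l (𝓝 (toWeakSpace ℝ X p)) ↔
      ∀ q : X, Tendsto (fun i => inner ℝ (x i) q) l (𝓝 (inner ℝ p q)) := by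
  refine (WeakBilin.tendsto_iff_forall_eval_tendsto (B := (topDualPairing ℝ X).flip)
    (f := fun i => toWeakSpace ℝ X (x i)) (x := toWeakSpace ℝ X p) ?_).trans ?_
  · intro a b h
    refine ext_inner_left ℝ fun q => ?_
    exact LinearMap.congr_fun h (InnerProductSpace.toDual ℝ X q)
  · constructor
    · intro h q
      have := h (InnerProductSpace.toDual ℝ X q)
      simp only [real_inner_comm q]
      exact this
    · intro h φ
      have := h ((InnerProductSpace.toDual ℝ X).symm φ)
      simp only [real_inner_comm ((InnerProductSpace.toDual ℝ X).symm φ),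
        InnerProductSpace.toDual_symm_apply] at this
      exact this

/-- Along an ultrafilter every bounded family converges weakly, by Banach-Alaoglu. -/
theorem exists_weak_limit_ultrafilter {ι : Type*} (F : Ultrafilter ι) {x : ι → X} {M : ℝ}
    (hx : ∀ i, ‖x i‖ ≤ M) :
    ∃ p : X, ∀ q : X, Tendsto (fun i => inner ℝ (x i) q) F (𝓝 (inner ℝ p q)) := by
  let ψ : ι → WeakDual ℝ X := fun i =>
    StrongDual.toWeakDual (InnerProductSpace.toDual ℝ X (x i))
  have hmem : ∀ i, ψ i ∈ WeakDual.toStrongDual ⁻¹' Metric.closedBall (0 : StrongDual ℝ X) M := by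
    intro i
    simp only [Set.mem_preimage, mem_closedBall_zero_iff]
    exact (LinearIsometryEquiv.norm_map (InnerProductSpace.toDual ℝ X) (x i)).trans_le (hx i)
  obtain ⟨φ, -, hφ⟩ := (WeakDual.isCompact_closedBall (𝕜 := ℝ) (0 : StrongDual ℝ X)
    M).ultrafilter_le_nhds (F.map ψ)
    (le_principal_iff.2 (Filter.mem_map.2 (Filter.univ_mem' hmem)))
  refine ⟨(InnerProductSpace.toDual ℝ X).symm (WeakDual.toStrongDual φ), fun q => ?_⟩
  rw [InnerProductSpace.toDual_symm_apply]
  exact ((WeakDual.eval_continuous q).tendsto φ).comp (hφ : Tendsto ψ F (𝓝 φ))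

/-- Opial-type criterion: a bounded sequence whose weak cluster points lie in `S`, and whose
inner products with differences of points of `S` converge, converges weakly to a point of `S`. -/
theorem exists_tendsto_weak_of_cluster_mem {S : Set X} {x : ℕ → X} {M : ℝ}
    (hx : ∀ t, ‖x t‖ ≤ M)
    (hS : ∀ (F : Ultrafilter ℕ) (p : X), (F : Filter ℕ) ≤ atTop →
      (∀ q : X, Tendsto (fun t => inner ℝ (x t) q) F (𝓝 (inner ℝ p q))) → p ∈ S)
    (hdiff : ∀ p ∈ S, ∀ q ∈ S, ∃ l : ℝ, Tendsto (fun t => inner ℝ (x t) (p - q)) atTop (𝓝 l)) :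
    ∃ p ∈ S, ∀ q : X, Tendsto (fun t => inner ℝ (x t) q) atTop (𝓝 (inner ℝ p q)) := by
  choose w hw using fun F : Ultrafilter ℕ => exists_weak_limit_ultrafilter F hx
  have hwS : ∀ F : Ultrafilter ℕ, (F : Filter ℕ) ≤ atTop → w F ∈ S :=
    fun F hF => hS F (w F) hF (hw F)
  let F₀ : Ultrafilter ℕ := Ultrafilter.of atTop
  have hF₀ : (F₀ : Filter ℕ) ≤ atTop := Ultrafilter.of_le _
  refine ⟨w F₀, hwS F₀ hF₀, fun q => ?_⟩
  rw [tendsto_iff_ultrafilter]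
  intro F hF
  have heq : w F = w F₀ := by
    obtain ⟨l, hl⟩ := hdiff _ (hwS F hF) _ (hwS F₀ hF₀)
    have h1 := tendsto_nhds_unique (hw F (w F - w F₀)) (hl.mono_left hF)
    have h2 := tendsto_nhds_unique (hw F₀ (w F - w F₀)) (hl.mono_left hF₀)
    have h3 : inner ℝ (w F - w F₀) (w F - w F₀) = 0 := by
      rw [inner_sub_left, h1, h2, sub_self]
    exact sub_eq_zero.1 (inner_self_eq_zero.1 h3)
  rw [← heq]
  exact hw F q

end Weak

/-! ### Growth of the extrapolation parameters -/

section Parameters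

variable {a : ℕ → ℝ} {κ c : ℝ}

/-- Each of the three entries of the minimum is at least `a t` and yields one of the three upper
bounds for `a (t + 1) ^ 2`; the step from `0` to `1` is covered by `a 0 = a 1`. -/
theorem one_le_and_step_of_recursion (hκ : 0 ≤ κ) (hc : 0 ≤ c) (ha0 : a 0 = 1) (ha1 : a 1 = 1)
    (ha : ∀ t : ℕ, 1 ≤ t → a (t + 1) = min (a t * √(1 + κ))
      (min (√(a t ^ 2 + a t * c)) ((1 + √(1 + 4 * a t ^ 2)) / 2))) (t : ℕ) :
    1 ≤ a t ∧ a t ≤ a (t + 1) ∧ a (t + 1) ^ 2 - a (t + 1) ≤ a t ^ 2 ∧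
      a (t + 1) ^ 2 ≤ a t ^ 2 * (1 + κ) ∧ a (t + 1) ^ 2 ≤ a t ^ 2 + a t * c := by
  have hstep : ∀ t, 1 ≤ t → 1 ≤ a t → a t ≤ a (t + 1) := by
    intro t ht h1
    rw [ha t ht]
    refine le_min ?_ (le_min ?_ ?_)
    · exact le_mul_of_one_le_right (by linarith) (Real.one_le_sqrt.2 (by linarith))
    · exact Real.le_sqrt_of_sq_le (by nlinarith)
    · have : 2 * a t ≤ √(1 + 4 * a t ^ 2) := Real.le_sqrt_of_sq_le (by nlinarith)
      linarith
  have hone : ∀ t, 1 ≤ a t := by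
    intro t
    induction t with
    | zero => exact ha0.ge
    | succ t ih =>
      rcases Nat.eq_zero_or_pos t with rfl | ht
      · exact ha1.ge
      · exact ih.trans (hstep t ht ih)
  refine ⟨hone t, ?_⟩
  rcases Nat.eq_zero_or_pos t with rfl | ht
  · rw [zero_add, ha0, ha1]
    norm_num
    exact ⟨hκ, hc⟩
  · have h1 := hone t
    have hA := hone (t + 1)
    have hm := ha t ht
    refine ⟨hstep t ht h1, ?_, ?_, ?_⟩
    · have h : a (t + 1) ≤ (1 + √(1 + 4 * a t ^ 2)) / 2 :=
        hm.trans_le ((min_le_right _ _).trans (min_le_right _ _))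
      have hs := Real.sq_sqrt (show 0 ≤ 1 + 4 * a t ^ 2 by positivity)
      have : (2 * a (t + 1) - 1) ^ 2 ≤ √(1 + 4 * a t ^ 2) ^ 2 :=
        pow_le_pow_left₀ (by linarith) (by linarith) 2
      nlinarith
    · have h : a (t + 1) ≤ a t * √(1 + κ) := hm.trans_le (min_le_left _ _)
      have := pow_le_pow_left₀ (by linarith) h 2
      rwa [mul_pow, Real.sq_sqrt (by linarith)] at this
    · have h : a (t + 1) ≤ √(a t ^ 2 + a t * c) :=
        hm.trans_le ((min_le_right _ _).trans (min_le_left _ _))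
      have := pow_le_pow_left₀ (by linarith) h 2
      rwa [Real.sq_sqrt (by nlinarith)] at this

theorem exists_add_le_of_recursion (hκ : 0 < κ) (hc : 0 < c) (hone : ∀ t, 1 ≤ a t)
    (ha : ∀ t : ℕ, 1 ≤ t → a (t + 1) = min (a t * √(1 + κ))
      (min (√(a t ^ 2 + a t * c)) ((1 + √(1 + 4 * a t ^ 2)) / 2))) :
    ∃ d > 0, ∀ t, 1 ≤ t → a t + d ≤ a (t + 1) := by
  -- `3 d ≤ min κ c` and `d ≤ 1` give `(r + d)² ≤ r² + 3 r d` for `r ≥ 1`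
  refine ⟨min (1 / 2) (min (κ / 3) (c / 3)), by positivity, fun t ht => ?_⟩
  set d := min (1 / 2) (min (κ / 3) (c / 3)) with hd
  have hd0 : 0 < d := by positivity
  have hd1 : d ≤ 1 / 2 := min_le_left _ _
  have hd2 : d ≤ κ / 3 := (min_le_right _ _).trans (min_le_left _ _)
  have hd3 : d ≤ c / 3 := (min_le_right _ _).trans (min_le_right _ _)
  have h1 := hone t
  have hsq : (a t + d) ^ 2 ≤ a t ^ 2 + 3 * (a t * d) := by nlinarith
  rw [ha t ht]
  refine le_min ?_ (le_min ?_ ?_)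
  · rw [← Real.sqrt_sq (show 0 ≤ a t by linarith), ← Real.sqrt_mul (sq_nonneg _),
      Real.sqrt_sq (show 0 ≤ a t by linarith)]
    refine Real.le_sqrt_of_sq_le (hsq.trans ?_)
    have h2 : a t * d ≤ a t ^ 2 * (κ / 3) := by
      rw [sq, mul_assoc]
      refine mul_le_mul_of_nonneg_left ?_ (by linarith)
      nlinarith
    linarith
  · refine Real.le_sqrt_of_sq_le (hsq.trans ?_)
    nlinarith
  · have : 2 * a t ≤ √(1 + 4 * a t ^ 2) := Real.le_sqrt_of_sq_le (by nlinarith)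
    linarith

theorem isTheta_natCast_of_increments {d : ℝ} (hd : 0 < d) (hone : ∀ t, 1 ≤ a t) (ha0 : a 0 = 1)
    (ha1 : a 1 = 1) (hlow : ∀ t, 1 ≤ t → a t + d ≤ a (t + 1))
    (hup : ∀ t, a (t + 1) ^ 2 - a (t + 1) ≤ a t ^ 2) :
    a =Θ[atTop] (fun t : ℕ => (t : ℝ)) ∧ (∀ t, a t ≤ t + 1) := by
  have hle : ∀ t : ℕ, a t ≤ t + 1 := by
    intro t
    induction t with
    | zero => simp [ha0]
    | succ t ih =>
      have := hone t
      have := hone (t + 1)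
      have := hup t
      push_cast
      nlinarith
  have hge : ∀ t : ℕ, 1 ≤ t → min d 1 * t ≤ a t := by
    intro t ht
    induction t, ht using Nat.le_induction with
    | base => simp [ha1]
    | succ t ht ih =>
      have := hlow t ht
      have := min_le_left d 1
      push_cast
      linarith
  refine ⟨⟨IsBigO.of_bound 2 ?_, IsBigO.of_bound (min d 1)⁻¹ ?_⟩, hle⟩
  · filter_upwards [eventually_ge_atTop 1] with t ht
    have h1 : (1 : ℝ) ≤ t := by exact_mod_cast ht
    rw [Real.norm_of_nonneg (by linarith [hone t]), Real.norm_of_nonneg (by linarith)]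
    linarith [hle t]
  · filter_upwards [eventually_ge_atTop 1] with t ht
    have hm : 0 < min d 1 := by positivity
    rw [Real.norm_natCast, Real.norm_of_nonneg (by linarith [hone t]), inv_mul_eq_div,
      le_div_iff₀ hm]
    linarith [hge t ht]

theorem tendsto_sum_one_div_atTop (hone : ∀ t, 1 ≤ a t) (hle : ∀ t : ℕ, a t ≤ t + 1) :
    Tendsto (fun T : ℕ => ∑ t ∈ Finset.range T, 1 / a (t + 1)) atTop atTop := by
  have h1 : Tendsto (fun n => ∑ t ∈ Finset.range n, 1 / ((t : ℝ) + 1)) atTop atTop :=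
    Real.tendsto_sum_range_one_div_nat_succ_atTop
  refine tendsto_atTop_mono (fun n => ?_) (h1.const_mul_atTop (show (0 : ℝ) < 1 / 2 by norm_num))
  rw [Finset.mul_sum]
  refine Finset.sum_le_sum fun t _ => ?_
  have h2 := hle (t + 1)
  have h3 := hone (t + 1)
  push_cast at h2
  have ht : (0 : ℝ) ≤ t := Nat.cast_nonneg _
  have e : 1 / 2 * (1 / ((t : ℝ) + 1)) = 1 / (2 * ((t : ℝ) + 1)) := by field_simp
  rw [e]
  exact one_div_le_one_div_of_le (by linarith) (by linarith)

end Parameters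

/-! ### One step of the algorithm -/

section Step

variable {X U : Type*} [NormedAddCommGroup X] [InnerProductSpace ℝ X] [CompleteSpace X]
  [NormedAddCommGroup U] [InnerProductSpace ℝ U] [CompleteSpace U] {f : X → ℝ}

/-- The Bregman divergence of `q` from the base point `p`: the error at `q` of the first-order
model of `f` at `p`. -/
noncomputable def bregman (f : X → ℝ) (p q : X) : ℝ := f q - f p - inner ℝ (gradient f p) (q - p)

theorem bregman_nonneg (hc : ConvexOn ℝ Set.univ f) (hf : Differentiable ℝ f) (p q : X) :
    0 ≤ bregman f p q := by
  have := add_inner_gradient_le hc hf p q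
  unfold bregman
  linarith

/-- Accelerated descent for the extrapolated point `q`, the averages `x`, `x'` and the step
`z' - z`. -/
theorem sq_mul_bregman_le (hc : ConvexOn ℝ Set.univ f) (hf : Differentiable ℝ f) {L : ℝ}
    (hL0 : 0 < L) (hL : ∀ p q : X, ‖gradient f p - gradient f q‖ ≤ L * ‖p - q‖)
    {A : ℝ} (hA : 1 ≤ A) {p x z z' q x' : X} (hq : q = (1 - 1 / A) • x + (1 / A) • z)
    (hx' : x' = (1 - 1 / A) • x + (1 / A) • z') :
    A ^ 2 * bregman f p x' ≤ (A ^ 2 - A) * bregman f p x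
      - A / (2 * L) * ‖gradient f q - gradient f p‖ ^ 2
      + A * inner ℝ (gradient f q - gradient f p) (z' - p) + L / 2 * ‖z' - z‖ ^ 2 := by
  have hA0 : A ≠ 0 := by positivity
  have h1 := le_add_inner_gradient_add_sq hf hL q x'
  have h2 := add_inner_gradient_le hc hf q x
  have h3 := add_inner_gradient_add_sq_le hc hf hL0 hL q p
  have e1 : x' - q = (1 / A) • (z' - z) := by rw [hx', hq]; module
  have e2 : A • (x' - q) = (A - 1) • (x - q) + (z' - q) := by
    rw [hx', smul_sub, smul_add, smul_smul, smul_smul, mul_sub, mul_one_div_cancel hA0]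
    module
  have e3 : ‖x' - q‖ ^ 2 = ‖z' - z‖ ^ 2 / A ^ 2 := by
    rw [e1, norm_smul, mul_pow, Real.norm_of_nonneg (by positivity), div_pow]; ring
  have e4 : A * inner ℝ (gradient f q) (x' - q)
      = (A - 1) * inner ℝ (gradient f q) (x - q) + inner ℝ (gradient f q) (z' - q) := by
    rw [← inner_smul_right, e2, inner_add_right, inner_smul_right]
  have e5 : A * inner ℝ (gradient f p) (x' - p)
      = (A - 1) * inner ℝ (gradient f p) (x - p) + inner ℝ (gradient f p) (z' - p) := by
    rw [← inner_smul_right, ← inner_smul_right, ← inner_add_right]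
    congr 1
    rw [hx', smul_sub, smul_add, smul_smul, smul_smul, mul_sub, mul_one_div_cancel hA0]
    module
  have e6 : inner ℝ (gradient f q) (z' - q) = inner ℝ (gradient f q) (p - q)
      + inner ℝ (gradient f q) (z' - p) := by
    rw [← inner_add_right]; congr 1; abel
  rw [norm_sub_rev] at h3
  rw [e3] at h1
  have h1' := mul_le_mul_of_nonneg_left h1 (sq_nonneg A)
  have h2' := mul_le_mul_of_nonneg_left h2 (show 0 ≤ A ^ 2 - A by nlinarith)
  have h3' := mul_le_mul_of_nonneg_left h3 (show 0 ≤ A by linarith)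
  have e7 : A ^ 2 * (L / 2 * (‖z' - z‖ ^ 2 / A ^ 2)) = L / 2 * ‖z' - z‖ ^ 2 := by field_simp
  have e8 : A / (2 * L) * ‖gradient f q - gradient f p‖ ^ 2
      = A * (1 / (2 * L) * ‖gradient f q - gradient f p‖ ^ 2) := by ring
  rw [inner_sub_left, e8]
  unfold bregman
  linear_combination h1' + h2' + h3' + A * e4 - A * e5 + A * e6 + e7

theorem prox_form_identity (T : X →L[ℝ] U) (α γ : ℝ) (w w' : U) :
    2 * (α * inner ℝ (w' - w) w'
        - γ * inner ℝ (T.adjoint (w' - w)) (T.adjoint w'))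
      = (α * ‖w'‖ ^ 2 - γ * ‖T.adjoint w'‖ ^ 2) - (α * ‖w‖ ^ 2 - γ * ‖T.adjoint w‖ ^ 2)
        + (α * ‖w' - w‖ ^ 2 - γ * ‖T.adjoint (w' - w)‖ ^ 2) := by
  simp only [map_sub, norm_sub_sq_real, inner_sub_left, real_inner_self_eq_norm_sq]
  rw [real_inner_comm w' w, real_inner_comm (T.adjoint w') (T.adjoint w)]
  ring

/-- The operator `P = τ⁻¹ - γ K K*` lies between `0` and `τ⁻¹`, hence `‖P d‖² ≤ τ⁻¹ ⟪P d, d⟫`. -/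
theorem norm_sq_preconditioner_le (K : X →L[ℝ] U) {γ τ : ℝ} (hγ : 0 < γ) (hτ : 0 < τ)
    (h : γ * τ * ‖K‖ ^ 2 ≤ 1) (d : U) :
    τ * ‖(1 / τ) • d - γ • K (K.adjoint d)‖ ^ 2
      ≤ 1 / τ * ‖d‖ ^ 2 - γ * ‖K.adjoint d‖ ^ 2 := by
  have h1 : inner ℝ d (K (K.adjoint d)) = ‖K.adjoint d‖ ^ 2 := by
    rw [← ContinuousLinearMap.adjoint_inner_left, real_inner_self_eq_norm_sq]
  have h2 : ‖K (K.adjoint d)‖ ^ 2 ≤ ‖K‖ ^ 2 * ‖K.adjoint d‖ ^ 2 := by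
    rw [← mul_pow]
    exact pow_le_pow_left₀ (norm_nonneg _) (K.le_opNorm _) 2
  rw [norm_sub_sq_real, inner_smul_left, inner_smul_right, h1, norm_smul, norm_smul, mul_pow,
    mul_pow, Real.norm_of_nonneg hγ.le, Real.norm_of_nonneg (by positivity)]
  have e : τ * ((1 / τ) ^ 2 * ‖d‖ ^ 2 - 2 * ((1 / τ) * (γ * ‖K.adjoint d‖ ^ 2))
      + γ ^ 2 * ‖K (K.adjoint d)‖ ^ 2)
      = 1 / τ * ‖d‖ ^ 2 - 2 * γ * ‖K.adjoint d‖ ^ 2 + γ * (γ * τ) * ‖K (K.adjoint d)‖ ^ 2 := by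
    field_simp
  have h3 := mul_le_mul_of_nonneg_left h2 (show 0 ≤ γ * (γ * τ) by positivity)
  have h4 := mul_le_mul_of_nonneg_right h
    (show 0 ≤ γ * ‖K.adjoint d‖ ^ 2 by positivity)
  simp only [conj_trivial]
  rw [e]
  linarith

/-- The two remainders of the primal step dominate a multiple of `‖k‖²`. With `k = K* (v' - us)`,
the lower spectral bound on `K K*` turns this into a gain in the dual error. -/
theorem young_residual {E : Type*} [NormedAddCommGroup E] {A γ L m : ℝ} (hA : 0 < A)
    (hγ : 0 < γ) (hL : 0 < L)
    (hm : m = min (1 / 2) (1 / (2 * A * γ * L))) (g k : E) :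
    m * (A ^ 2 * γ / 4) * ‖k‖ ^ 2
      ≤ A ^ 2 * γ / 4 * ‖g + k‖ ^ 2 + A / (2 * L) * ‖g‖ ^ 2 := by
  have hm1 : m ≤ 1 / 2 := hm.trans_le (min_le_left _ _)
  have hm2 : m ≤ 1 / (2 * A * γ * L) := hm.trans_le (min_le_right _ _)
  have hm0 : 0 ≤ m := by rw [hm]; positivity
  have h1 : ‖k‖ ^ 2 ≤ 2 * ‖g + k‖ ^ 2 + 2 * ‖g‖ ^ 2 := by
    have h : ‖k‖ ≤ ‖g + k‖ + ‖g‖ := by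
      simpa using norm_sub_le (g + k) g
    nlinarith [norm_nonneg k, norm_nonneg g, norm_nonneg (g + k), sq_nonneg (‖g + k‖ - ‖g‖)]
  have h2 : m * (A * γ * (2 * L)) ≤ 1 := by
    rw [le_div_iff₀ (by positivity)] at hm2
    linarith
  have h3 : m * (A ^ 2 * γ / 4) * 2 ≤ A / (2 * L) := by
    rw [le_div_iff₀ (by positivity)]
    nlinarith
  have h4 := mul_le_mul_of_nonneg_left h1 (show 0 ≤ m * (A ^ 2 * γ / 4) by positivity)
  have h5 := mul_le_mul_of_nonneg_right h3 (sq_nonneg ‖g‖)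
  have h6 := mul_le_mul_of_nonneg_right hm1 (show 0 ≤ A ^ 2 * γ / 4 * 2 * ‖g + k‖ ^ 2 by positivity)
  linarith

/-- The energy inequality for one step, with the new parameter `A` on both sides. -/
theorem energy_step (hc : ConvexOn ℝ Set.univ f) (hf : Differentiable ℝ f) {L : ℝ}
    (hL0 : 0 < L) (hL : ∀ p q : X, ‖gradient f p - gradient f q‖ ≤ L * ‖p - q‖)
    (K : X →L[ℝ] U) {γ τ lam A m : ℝ} (hγ : 0 < γ) (hγL : γ ≤ 1 / (2 * L)) (hτ : 0 < τ)
    (hK : γ * τ * ‖K‖ ^ 2 ≤ 1) (hA : 1 ≤ A) (hm : m = min (1 / 2) (1 / (2 * A * γ * L)))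
    {b us v v' : U} {p x z z' q x' : X} (hp : gradient f p + K.adjoint us = 0) (hpb : K p = b)
    (hlam : lam * ‖v' - us‖ ^ 2 ≤ ‖K.adjoint (v' - us)‖ ^ 2)
    (hq : q = (1 - 1 / A) • x + (1 / A) • z) (hx' : x' = (1 - 1 / A) • x + (1 / A) • z')
    (hz' : z' = z - (A * γ) • gradient f q - (A * γ) • K.adjoint v')
    (hv' : v' = v + (τ / A) • (K z' + (A * γ) • K (K.adjoint (v' - v)) - b)) :
    1 / (2 * γ) * ‖z' - p‖ ^ 2 + (2 * A ^ 2 + m * γ * τ * A ^ 2 * lam) / (4 * τ) * ‖v' - us‖ ^ 2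
        - A ^ 2 * γ / 2 * ‖K.adjoint (v' - us)‖ ^ 2 + A ^ 2 * bregman f p x'
        + τ / 2 * ‖K z' - b‖ ^ 2
      ≤ 1 / (2 * γ) * ‖z - p‖ ^ 2 + A ^ 2 / (2 * τ) * ‖v - us‖ ^ 2
        - A ^ 2 * γ / 2 * ‖K.adjoint (v - us)‖ ^ 2 + (A ^ 2 - A) * bregman f p x := by
  have hA0 : 0 < A := by linarith
  set g := gradient f q - gradient f p with hg
  set k := K.adjoint (v' - us) with hk
  have hgk : gradient f q + K.adjoint v' = g + k := by
    have : gradient f p = -K.adjoint us := eq_neg_of_add_eq_zero_left hp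
    rw [hg, hk, map_sub, this]; abel
  have hzz : z' - z = -((A * γ) • (g + k)) := by rw [← hgk, hz']; module
  have hfun := sq_mul_bregman_le (p := p) hc hf hL0 hL hA hq hx'
  rw [← hg] at hfun
  -- the primal step
  have hprim : 1 / (2 * γ) * ‖z - p‖ ^ 2 = 1 / (2 * γ) * ‖z' - p‖ ^ 2
      + A * inner ℝ g (z' - p) + A * inner ℝ k (z' - p) + 1 / (2 * γ) * ‖z' - z‖ ^ 2 := by
    have : z - p = (z' - p) - (z' - z) := by abel
    rw [this, norm_sub_sq_real, hzz, inner_neg_right, inner_smul_right, inner_add_right,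
      real_inner_comm (z' - p), real_inner_comm (z' - p)]
    field_simp
    ring
  have hnorm : ‖z' - z‖ ^ 2 = A ^ 2 * γ ^ 2 * ‖g + k‖ ^ 2 := by
    rw [hzz, norm_neg, norm_smul, mul_pow, Real.norm_of_nonneg (by positivity), mul_pow]
  -- the dual step
  have hdual : K z' - b = A • ((1 / τ) • (v' - v) - γ • K (K.adjoint (v' - v))) := by
    have h1 : v' - v = (τ / A) • (K z' + (A * γ) • K (K.adjoint (v' - v)) - b) :=
      sub_eq_of_eq_add' hv'
    have h2 : (A / τ) • (v' - v) = K z' + (A * γ) • K (K.adjoint (v' - v)) - b := by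
      conv_lhs => rw [h1]
      rw [smul_smul, div_mul_div_cancel₀ hτ.ne', div_self hA0.ne', one_smul]
    have h3 : K z' - b = (A / τ) • (v' - v) - (A * γ) • K (K.adjoint (v' - v)) := by
      rw [h2]; abel
    rw [h3]
    module
  have hkz : A * inner ℝ k (z' - p) = A ^ 2 * (1 / τ * inner ℝ (v' - v) (v' - us)
      - γ * inner ℝ (K.adjoint (v' - v)) (K.adjoint (v' - us))) := by
    have h1 : inner ℝ k (z' - p) = inner ℝ (K z' - b) (v' - us) := by
      rw [hk, ContinuousLinearMap.adjoint_inner_left, map_sub, hpb, real_inner_comm]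
    rw [h1, hdual, inner_smul_left, inner_sub_left, inner_smul_left, inner_smul_left,
      ContinuousLinearMap.adjoint_inner_right]
    simp only [conj_trivial]
    ring
  have hid := prox_form_identity K (1 / τ) γ (v - us) (v' - us)
  rw [show v' - us - (v - us) = v' - v by abel] at hid
  have hpre := norm_sq_preconditioner_le K hγ hτ hK (v' - v)
  have hres : ‖K z' - b‖ ^ 2
      = A ^ 2 * ‖(1 / τ) • (v' - v) - γ • K (K.adjoint (v' - v))‖ ^ 2 := by
    rw [hdual, norm_smul, mul_pow, Real.norm_of_nonneg hA0.le]
  have hpre' := mul_le_mul_of_nonneg_left hpre (sq_nonneg A)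
  have hyoung := young_residual hA0 hγ hL0 hm g k
  have hm0 : 0 ≤ m := by rw [hm]; positivity
  have hcon := mul_le_mul_of_nonneg_left hlam (show 0 ≤ m * (A ^ 2 * γ / 4) by positivity)
  -- `γ ≤ 1 / (2 L)` leaves the fraction `1 / (4 γ)` of the squared primal step
  have hLγ : L / 2 ≤ 1 / (2 * γ) - 1 / (4 * γ) := by
    rw [le_div_iff₀ (by positivity)] at hγL
    have : 1 / (2 * γ) - 1 / (4 * γ) = 1 / (4 * γ) := by field_simp; norm_num
    rw [this, le_div_iff₀ (by positivity)]
    linarith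
  have hstep := mul_le_mul_of_nonneg_right hLγ (sq_nonneg ‖z' - z‖)
  have hquarter : 1 / (4 * γ) * ‖z' - z‖ ^ 2 = A ^ 2 * γ / 4 * ‖g + k‖ ^ 2 := by
    rw [hnorm]; field_simp
  have e1 : (2 * A ^ 2 + m * γ * τ * A ^ 2 * lam) / (4 * τ) * ‖v' - us‖ ^ 2
      = A ^ 2 / 2 * (1 / τ * ‖v' - us‖ ^ 2)
        + m * (A ^ 2 * γ / 4) * (lam * ‖v' - us‖ ^ 2) := by
    field_simp; ring
  have e2 : A ^ 2 / (2 * τ) * ‖v - us‖ ^ 2 = A ^ 2 / 2 * (1 / τ * ‖v - us‖ ^ 2) := by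
    field_simp
  rw [e1, e2, hres]
  linear_combination hfun - hprim - hkz - A ^ 2 / 2 * hid + hpre' / 2 + hyoung + hcon + hstep
    - hquarter

end Step

section SaddlePoints

variable {X U : Type*} [NormedAddCommGroup X] [InnerProductSpace ℝ X]
  [NormedAddCommGroup U] [InnerProductSpace ℝ U]

/-! ### The linear conjugate `h* = ⟪·, b⟫` -/

theorem mem_subdifferential_conjugate_indicatorPoint {b u w : U} :
    w ∈ subdifferential (conjugate (indicatorPoint b)) u ↔ w = b := by
  simp only [subdifferential, Set.mem_ofPred_eq, conjugate_indicatorPoint]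
  constructor
  · intro h
    have h1 := h (u + (w - b))
    rw [← EReal.coe_add, EReal.coe_le_coe_iff, add_sub_cancel_left, inner_add_left] at h1
    have h2 : inner ℝ (w - b) (w - b) ≤ 0 := by rw [inner_sub_right]; linarith
    exact sub_eq_zero.1 (real_inner_self_nonpos.1 h2)
  · rintro rfl v
    rw [← EReal.coe_add, EReal.coe_le_coe_iff, inner_sub_left]
    linarith

theorem IsProx.eq_sub_smul {b q p : U} {c : ℝ}
    (h : IsProx (fun w => (c : EReal) * conjugate (indicatorPoint b) w) q p) :
    p = q - c • b := by
  have h1 := h (q - c • b)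
  simp only [conjugate_indicatorPoint] at h1
  rw [← EReal.coe_mul, ← EReal.coe_mul, ← EReal.coe_add, ← EReal.coe_add,
    EReal.coe_le_coe_iff] at h1
  have e1 : ‖q - c • b - q‖ ^ 2 = c ^ 2 * ‖b‖ ^ 2 := by
    rw [sub_sub_cancel_left, norm_neg, norm_smul, mul_pow, Real.norm_eq_abs, sq_abs]
  have e2 : ‖p - q + c • b‖ ^ 2
      = ‖p - q‖ ^ 2 + 2 * (c * (inner ℝ p b - inner ℝ q b)) + c ^ 2 * ‖b‖ ^ 2 := by
    rw [norm_add_sq_real, inner_smul_right, inner_sub_left, norm_smul, mul_pow, Real.norm_eq_abs,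
      sq_abs]
  rw [e1, inner_sub_left, inner_smul_left, real_inner_self_eq_norm_sq] at h1
  simp only [conj_trivial] at h1
  have h2 : ‖p - q + c • b‖ ^ 2 ≤ 0 := by rw [e2]; linarith
  have h3 : p - q + c • b = 0 := by
    rw [← norm_eq_zero]
    exact pow_eq_zero_iff two_ne_zero |>.1 (le_antisymm h2 (sq_nonneg _))
  rw [← sub_eq_zero, ← h3]
  abel

theorem range_sub_mem {K : X →L[ℝ] U} {w w' : U} (hw : w ∈ Set.range K) (hw' : w' ∈ Set.range K) :
    w - w' ∈ Set.range K := by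
  obtain ⟨p, rfl⟩ := hw
  obtain ⟨q, rfl⟩ := hw'
  exact ⟨p - q, map_sub _ _ _⟩

variable [CompleteSpace X] [CompleteSpace U] {f : X → ℝ} {K : X →L[ℝ] U} {b : U}

theorem isSaddlePoint_iff {p : X} {w : U} :
    IsSaddlePoint f 0 K (conjugate (indicatorPoint b)) p w ↔
      gradient f p + K.adjoint w = 0 ∧ K p = b := by
  simp [IsSaddlePoint, mem_subdifferential_conjugate_indicatorPoint]

theorem isConstrainedSolution_iff {p : X} {w : U} :
    IsConstrainedSolution f 0 K b p w ↔
      gradient f p + K.adjoint w = 0 ∧ w ∈ Set.range K ∧ K p = b := by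
  simp [IsConstrainedSolution]

/-- The Lagrangian gap at a saddle point is the Bregman divergence of `f`; it does not depend on
the second dual variable. -/
theorem gap_eq_bregman {p : X} {w : U} (hp : gradient f p + K.adjoint w = 0) (hpb : K p = b)
    (q : X) (w' : U) :
    gap f 0 K (conjugate (indicatorPoint b)) p w q w' = bregman f p q := by
  have h := coe_gap f 0 K b p w q w'
  simp only [lagrangian, conjugate_indicatorPoint] at h
  rw [← EReal.coe_sub, ← EReal.coe_sub, ← EReal.coe_sub, EReal.coe_eq_coe_iff] at h
  have h1 : gradient f p = -K.adjoint w := eq_neg_of_add_eq_zero_left hp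
  rw [h, bregman, h1, inner_neg_left, ContinuousLinearMap.adjoint_inner_left, map_sub,
    inner_sub_right, hpb, real_inner_comm w', real_inner_comm w]
  ring

/-- All saddle points share the gradient of `f`, and the Bregman divergence from each of them is
the same function. -/
theorem gradient_eq_and_bregman_eq (hc : ConvexOn ℝ Set.univ f) (hf : Differentiable ℝ f) {L : ℝ}
    (hL0 : 0 < L) (hL : ∀ p q : X, ‖gradient f p - gradient f q‖ ≤ L * ‖p - q‖)
    {p p' : X} {w w' : U} (hp : gradient f p + K.adjoint w = 0) (hpb : K p = b)
    (hp' : gradient f p' + K.adjoint w' = 0) (hpb' : K p' = b) :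
    gradient f p' = gradient f p ∧ ∀ q, bregman f p' q = bregman f p q := by
  have h0 : gradient f p = -K.adjoint w := eq_neg_of_add_eq_zero_left hp
  have h0' : gradient f p' = -K.adjoint w' := eq_neg_of_add_eq_zero_left hp'
  have hz : inner ℝ (gradient f p) (p' - p) = 0 := by
    rw [h0, inner_neg_left, ContinuousLinearMap.adjoint_inner_left, map_sub, hpb, hpb', sub_self,
      inner_zero_right, neg_zero]
  have hz' : inner ℝ (gradient f p') (p - p') = 0 := by
    rw [h0', inner_neg_left, ContinuousLinearMap.adjoint_inner_left, map_sub, hpb, hpb', sub_self,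
      inner_zero_right, neg_zero]
  have h1 := add_inner_gradient_add_sq_le hc hf hL0 hL p p'
  have h2 := add_inner_gradient_le hc hf p' p
  rw [hz] at h1
  rw [hz'] at h2
  have hc0 : 0 < 1 / (2 * L) := by positivity
  have h3 : ‖gradient f p' - gradient f p‖ ^ 2 = 0 := by
    by_contra hne
    have := mul_pos hc0 (lt_of_le_of_ne (sq_nonneg _) (Ne.symm hne))
    linarith
  have hg : gradient f p' = gradient f p :=
    sub_eq_zero.1 (norm_eq_zero.1 (pow_eq_zero_iff two_ne_zero |>.1 h3))
  refine ⟨hg, fun q => ?_⟩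
  have hfp : f p' = f p := by
    rw [h3] at h1
    linarith
  have e : q - p' = (q - p) - (p' - p) := by abel
  rw [bregman, bregman, hg, hfp, e, inner_sub_right, hz, sub_zero]

theorem lambdaMinPos_mul_sq_le {w : U} (hw : w ∈ Set.range K) :
    lambdaMinPos K * ‖w‖ ^ 2 ≤ ‖K.adjoint w‖ ^ 2 := by
  rcases eq_or_ne w 0 with rfl | hne
  · simp
  · rw [← le_div_iff₀ (by positivity)]
    refine csInf_le ⟨0, ?_⟩ ⟨w, subset_closure hw, hne, rfl⟩
    rintro r ⟨u, -, -, rfl⟩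
    positivity

/-- Strong duality: the dual optimal value is `-f p`, and equality in the Fenchel inequality at
`p` identifies `K* w` for every dual solution `w`; positivity of `λ⁺_min(K K*)` makes `K*`
injective on the range of `K`. -/
theorem isDualSolution_iff_eq (hc : ConvexOn ℝ Set.univ f) (hf : Differentiable ℝ f)
    (hlam : 0 < lambdaMinPos K) {p : X} {us w : U} (hp : gradient f p + K.adjoint us = 0)
    (hus : us ∈ Set.range K) (hpb : K p = b) (hw : w ∈ Set.range K) :
    IsDualSolution f 0 K (conjugate (indicatorPoint b)) w ↔ w = us := by
  have hgr : gradient f p = -K.adjoint us := eq_neg_of_add_eq_zero_left hp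
  -- each point of the primal space gives a lower bound for the dual objective
  have hfen : ∀ (q : X) (w : U), ((inner ℝ q (-K.adjoint w) - f q + inner ℝ w b : ℝ) : EReal) ≤
      dualObjective f 0 K (conjugate (indicatorPoint b)) w := by
    intro q w
    rw [dualObjective, conjugate_indicatorPoint, EReal.coe_add, EReal.coe_sub]
    refine add_le_add_left ?_ _
    simp only [conjugate, zero_div, zero_mul, add_zero]
    exact le_iSup (fun q : X => ((inner ℝ q (-K.adjoint w) : ℝ) : EReal) - (f q : EReal)) q
  have hlow : ∀ w : U, ((-f p : ℝ) : EReal) ≤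
      dualObjective f 0 K (conjugate (indicatorPoint b)) w := by
    intro w
    refine le_trans (le_of_eq ?_) (hfen p w)
    rw [inner_neg_right, ContinuousLinearMap.adjoint_inner_right, hpb, real_inner_comm b w]
    congr 1
    ring
  have hval : dualObjective f 0 K (conjugate (indicatorPoint b)) us ≤ ((-f p : ℝ) : EReal) := by
    have h1 : conjugate (fun x : X => ((f x + 0 / 2 * ‖x‖ ^ 2 : ℝ) : EReal)) (-(K.adjoint us))
        ≤ ((-f p - inner ℝ us b : ℝ) : EReal) := by
      refine iSup_le fun q => ?_
      rw [← EReal.coe_sub, EReal.coe_le_coe_iff]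
      have h2 := add_inner_gradient_le hc hf p q
      rw [hgr, inner_sub_right, inner_neg_left, inner_neg_left,
        ContinuousLinearMap.adjoint_inner_left, ContinuousLinearMap.adjoint_inner_left, hpb] at h2
      rw [inner_neg_right, ContinuousLinearMap.adjoint_inner_right, real_inner_comm]
      linarith
    rw [dualObjective, conjugate_indicatorPoint]
    refine (add_le_add_left h1 _).trans (le_of_eq ?_)
    rw [← EReal.coe_add]
    congr 1
    ring
  constructor
  · intro h
    have hle := (h us).trans hval
    -- `p` maximizes `q ↦ ⟪q, -K* w⟫ - f q`, so the gradient of this function vanishes at `p`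
    have hmax : ∀ q, f p - inner ℝ (-K.adjoint w) p ≤ f q - inner ℝ (-K.adjoint w) q := by
      intro q
      have h1 := (hfen q w).trans hle
      rw [EReal.coe_le_coe_iff] at h1
      have h2 : inner ℝ (-K.adjoint w) p = -inner ℝ w b := by
        rw [inner_neg_left, ContinuousLinearMap.adjoint_inner_left, hpb]
      rw [h2, real_inner_comm q]
      linarith
    have hder : HasDerivAt (fun r : ℝ => f (p + r • (gradient f p + K.adjoint w))
        - inner ℝ (-K.adjoint w) (p + r • (gradient f p + K.adjoint w)))
        (‖gradient f p + K.adjoint w‖ ^ 2) 0 := by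
      have h1 := hasDerivAt_comp_line hf p (gradient f p + K.adjoint w) 0
      have h2 : HasDerivAt (fun r : ℝ => inner ℝ (-K.adjoint w)
          (p + r • (gradient f p + K.adjoint w)))
          (inner ℝ (-K.adjoint w) (gradient f p + K.adjoint w)) 0 := by
        simp only [inner_add_right _ p, inner_smul_right]
        simpa using ((hasDerivAt_id (0 : ℝ)).mul_const
          (inner ℝ (-K.adjoint w) (gradient f p + K.adjoint w))).const_add
            (inner ℝ (-K.adjoint w) p)
      refine (h1.sub h2).congr_deriv ?_
      rw [zero_smul, add_zero, ← inner_sub_left, sub_neg_eq_add, real_inner_self_eq_norm_sq]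
    have hmin : IsLocalMin (fun r : ℝ => f (p + r • (gradient f p + K.adjoint w))
        - inner ℝ (-K.adjoint w) (p + r • (gradient f p + K.adjoint w))) 0 := by
      refine Filter.Eventually.of_forall fun r => ?_
      simpa only [zero_smul, add_zero] using hmax (p + r • (gradient f p + K.adjoint w))
    have h0 := hmin.hasDerivAt_eq_zero hder
    have hzero : gradient f p + K.adjoint w = 0 :=
      norm_eq_zero.1 (pow_eq_zero_iff two_ne_zero |>.1 h0)
    have hKw : K.adjoint (w - us) = 0 := by
      rw [map_sub, eq_neg_of_add_eq_zero_right hzero, hgr, neg_neg, sub_self]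
    have h2 := lambdaMinPos_mul_sq_le (range_sub_mem hw hus)
    rw [hKw, norm_zero, zero_pow two_ne_zero] at h2
    have h3 : ‖w - us‖ ^ 2 = 0 := by
      by_contra hne
      have := mul_pos hlam (lt_of_le_of_ne (sq_nonneg _) (Ne.symm hne))
      linarith
    exact sub_eq_zero.1 (norm_eq_zero.1 (pow_eq_zero_iff two_ne_zero |>.1 h3))
  · rintro rfl u'
    exact hval.trans (hlow u')

end SaddlePoints

section Run

variable {X U : Type*} [NormedAddCommGroup X] [InnerProductSpace ℝ X] [CompleteSpace X]
  [NormedAddCommGroup U] [InnerProductSpace ℝ U] [CompleteSpace U]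
  {f : X → ℝ} {K : X →L[ℝ] U} {b : U}

/-! ### The Lyapunov function along a run -/

/-- A run of the algorithm for the constraint `K x = b`, with the proximal step written out and
the predicted point eliminated, together with the relations between the parameters on which the
energy estimate rests. -/
structure ConstrainedRun (f : X → ℝ) (L : ℝ) (K : X →L[ℝ] U) (b : U) (γ τ : ℝ) (a : ℕ → ℝ)
    (x y z : ℕ → X) (v : ℕ → U) : Prop where
  convex : ConvexOn ℝ Set.univ f
  differentiable : Differentiable ℝ f
  L_pos : 0 < L
  smooth : ∀ p q : X, ‖gradient f p - gradient f q‖ ≤ L * ‖p - q‖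
  γ_pos : 0 < γ
  γ_le : γ ≤ 1 / (2 * L)
  τ_pos : 0 < τ
  stepsize : γ * τ * ‖K‖ ^ 2 ≤ 1
  lam_pos : 0 < lambdaMinPos K
  one_le : ∀ t, 1 ≤ a t
  mono : ∀ t, a t ≤ a (t + 1)
  primal_growth : ∀ t, a (t + 1) ^ 2 - a (t + 1) ≤ a t ^ 2
  dual_growth : ∀ t, a (t + 1) ^ 2 ≤
    a t ^ 2 * (1 + min (1 / 2) (1 / (2 * a t * γ * L)) * γ * τ * lambdaMinPos K / 2)
  init : x 0 = z 0
  v_mem : ∀ t, v t ∈ Set.range K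
  y_step : ∀ t, y t = (1 - 1 / a (t + 1)) • x t + (1 / a (t + 1)) • z t
  v_step : ∀ t, v (t + 1) = v t + (τ / a (t + 1)) •
    (K (z (t + 1)) + (a (t + 1) * γ) • K (K.adjoint (v (t + 1) - v t)) - b)
  z_step : ∀ t, z (t + 1) = z t - (a (t + 1) * γ) • gradient f (y t)
    - (a (t + 1) * γ) • K.adjoint (v (t + 1))
  x_step : ∀ t, x (t + 1) = (1 - 1 / a (t + 1)) • x t + (1 / a (t + 1)) • z (t + 1)

/-- The terms of the Lyapunov function that do not involve the primal solution. -/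
noncomputable def dualEnergy (L : ℝ) (K : X →L[ℝ] U) (b : U) (γ τ : ℝ) (a : ℕ → ℝ)
    (x : ℕ → X) (v : ℕ → U) (us : U) (t : ℕ) : ℝ :=
  (2 * a t ^ 2 + min (1 / 2) (1 / (2 * a t * γ * L)) * γ * τ * a t ^ 2 * lambdaMinPos K)
        / (4 * τ) * ‖v t - us‖ ^ 2
    - a t ^ 2 * γ / 2 * ‖K.adjoint (v t - us)‖ ^ 2
    + a t * τ / 2 * ‖K (x t) - b‖ ^ 2

theorem tendsto_zero_of_descent {Ψ r : ℕ → ℝ} (hΨ : ∀ t, 0 ≤ Ψ t) (hr : ∀ t, 0 ≤ r t)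
    (h : ∀ t, Ψ (t + 1) + r (t + 1) ≤ Ψ t) : Tendsto r atTop (𝓝 0) := by
  have hanti : Antitone Ψ := antitone_nat_of_succ_le fun t => by linarith [h t, hr (t + 1)]
  have hlim := tendsto_atTop_ciInf hanti ⟨0, by rintro _ ⟨t, rfl⟩; exact hΨ t⟩
  rw [← tendsto_add_atTop_iff_nat 1]
  have hdiff := hlim.sub (hlim.comp (tendsto_add_atTop_nat 1))
  rw [sub_self] at hdiff
  exact squeeze_zero (fun t => hr _) (fun t => by simpa using (by linarith [h t] :
    r (t + 1) ≤ Ψ t - Ψ (t + 1))) hdiff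

namespace ConstrainedRun

variable {L γ τ : ℝ} {a : ℕ → ℝ} {x y z : ℕ → X} {v : ℕ → U} {u : ℕ → U} {p : X} {us : U}

theorem lyapunov_eq (hp : gradient f p + K.adjoint us = 0) (hpb : K p = b) (t : ℕ) :
    lyapunov f L K (conjugate (indicatorPoint b)) b γ τ a x z u v p us t
      = 1 / (2 * γ) * ‖z t - p‖ ^ 2 + a t ^ 2 * bregman f p (x t)
        + dualEnergy L K b γ τ a x v us t := by
  rw [lyapunov, gap_eq_bregman hp hpb, dualEnergy]
  ring

/-- The dual energy is coercive: `γ τ ‖K‖² ≤ 1` absorbs the negative term, and the part with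
`λ⁺_min(K K*)` still grows linearly in `a t`. -/
theorem le_dualEnergy (h : ConstrainedRun f L K b γ τ a x y z v) (us : U) (t : ℕ) :
    a t * (min (1 / 2) (1 / (2 * γ * L)) * γ * lambdaMinPos K / 4) * ‖v t - us‖ ^ 2
      + a t * τ / 2 * ‖K (x t) - b‖ ^ 2 ≤ dualEnergy L K b γ τ a x v us t := by
  have hγ := h.γ_pos
  have hτ := h.τ_pos
  have hL := h.L_pos
  have ha : 0 < a t := by linarith [h.one_le t]
  have hlam := h.lam_pos
  set w := v t - us
  set m := min (1 / 2) (1 / (2 * a t * γ * L))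
  have h1 : ‖K.adjoint w‖ ^ 2 ≤ ‖K‖ ^ 2 * ‖w‖ ^ 2 := by
    rw [← mul_pow]
    refine pow_le_pow_left₀ (norm_nonneg _) ((K.adjoint.le_opNorm w).trans_eq ?_) 2
    rw [LinearIsometryEquiv.norm_map]
  have h2 : γ * ‖K.adjoint w‖ ^ 2 ≤ 1 / τ * ‖w‖ ^ 2 := by
    rw [div_mul_eq_mul_div, le_div_iff₀ hτ, one_mul]
    have h3 := mul_le_mul_of_nonneg_left h1 (show 0 ≤ γ * τ by positivity)
    have h4 := mul_le_mul_of_nonneg_right h.stepsize (sq_nonneg ‖w‖)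
    linarith
  have h5 := mul_le_mul_of_nonneg_left h2 (show 0 ≤ a t ^ 2 / 2 by positivity)
  have h6 : a t * min (1 / 2) (1 / (2 * γ * L)) ≤ a t ^ 2 * m := by
    rw [sq, mul_assoc (a t) (a t)]
    refine mul_le_mul_of_nonneg_left ?_ ha.le
    rw [mul_min_of_nonneg _ _ ha.le]
    refine min_le_min (by linarith [h.one_le t]) (le_of_eq ?_)
    field_simp
  have h7 := mul_le_mul_of_nonneg_right h6
    (show 0 ≤ γ * lambdaMinPos K / 4 * ‖w‖ ^ 2 by positivity)
  have e : (2 * a t ^ 2 + m * γ * τ * a t ^ 2 * lambdaMinPos K) / (4 * τ) * ‖w‖ ^ 2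
      = a t ^ 2 / 2 * (1 / τ * ‖w‖ ^ 2)
        + a t ^ 2 * m * (γ * lambdaMinPos K / 4 * ‖w‖ ^ 2) := by
    field_simp
    ring
  rw [dualEnergy, e]
  linarith

theorem dualEnergy_nonneg (h : ConstrainedRun f L K b γ τ a x y z v) (us : U) (t : ℕ) :
    0 ≤ dualEnergy L K b γ τ a x v us t := by
  have hγ := h.γ_pos
  have hτ := h.τ_pos
  have hL := h.L_pos
  have ha : 0 < a t := by linarith [h.one_le t]
  have hlam := h.lam_pos
  refine le_trans ?_ (h.le_dualEnergy us t)
  positivity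

/-- The energy without the constraint violation of `x` decreases by at least `τ / 2` times the
squared constraint violation of `z`. -/
theorem lyapunov_descent (h : ConstrainedRun f L K b γ τ a x y z v)
    (hp : gradient f p + K.adjoint us = 0) (hus : us ∈ Set.range K) (hpb : K p = b) (t : ℕ) :
    lyapunov f L K (conjugate (indicatorPoint b)) b γ τ a x z u v p us (t + 1)
        - a (t + 1) * τ / 2 * ‖K (x (t + 1)) - b‖ ^ 2 + τ / 2 * ‖K (z (t + 1)) - b‖ ^ 2
      ≤ lyapunov f L K (conjugate (indicatorPoint b)) b γ τ a x z u v p us t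
        - a t * τ / 2 * ‖K (x t) - b‖ ^ 2 := by
  have hγ := h.γ_pos
  have hτ := h.τ_pos
  have ha : 0 < a t := by linarith [h.one_le t]
  have hstep := energy_step h.convex h.differentiable h.L_pos h.smooth K hγ h.γ_le hτ
    h.stepsize (h.one_le (t + 1)) rfl hp hpb
    (lambdaMinPos_mul_sq_le (range_sub_mem (h.v_mem (t + 1)) hus)) (h.y_step t) (h.x_step t)
    (h.z_step t) (h.v_step t)
  have hbr := mul_le_mul_of_nonneg_right (h.primal_growth t)
    (bregman_nonneg h.convex h.differentiable p (x t))
  have hK := mul_le_mul_of_nonneg_right (pow_le_pow_left₀ ha.le (h.mono t) 2)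
    (show 0 ≤ γ / 2 * ‖K.adjoint (v t - us)‖ ^ 2 by positivity)
  have hv := mul_le_mul_of_nonneg_right (h.dual_growth t)
    (show 0 ≤ 1 / (2 * τ) * ‖v t - us‖ ^ 2 by positivity)
  have e : (2 * a t ^ 2 + min (1 / 2) (1 / (2 * a t * γ * L)) * γ * τ * a t ^ 2 * lambdaMinPos K)
      / (4 * τ) * ‖v t - us‖ ^ 2
      = a t ^ 2 * (1 + min (1 / 2) (1 / (2 * a t * γ * L)) * γ * τ * lambdaMinPos K / 2)
        * (1 / (2 * τ) * ‖v t - us‖ ^ 2) := by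
    field_simp
    ring
  have e' : a (t + 1) ^ 2 / (2 * τ) * ‖v t - us‖ ^ 2
      = a (t + 1) ^ 2 * (1 / (2 * τ) * ‖v t - us‖ ^ 2) := by
    field_simp
  rw [e'] at hstep
  rw [lyapunov_eq hp hpb, lyapunov_eq hp hpb, dualEnergy, dualEnergy, e]
  linarith

theorem lyapunov_antitone (h : ConstrainedRun f L K b γ τ a x y z v)
    (hp : gradient f p + K.adjoint us = 0) (hus : us ∈ Set.range K) (hpb : K p = b) :
    Antitone (lyapunov f L K (conjugate (indicatorPoint b)) b γ τ a x z u v p us) := by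
  refine antitone_nat_of_succ_le fun t => ?_
  have hτ := h.τ_pos
  have hA := h.one_le (t + 1)
  have hdesc := h.lyapunov_descent (u := u) hp hus hpb t
  have hθ : 0 ≤ 1 - 1 / a (t + 1) := by
    rw [sub_nonneg, div_le_one (by linarith)]
    exact hA
  -- convexity of the squared constraint violation along the averaging step
  have hconv : ‖K (x (t + 1)) - b‖ ^ 2 ≤ (1 - 1 / a (t + 1)) * ‖K (x t) - b‖ ^ 2
      + 1 / a (t + 1) * ‖K (z (t + 1)) - b‖ ^ 2 := by
    have h1 : K (x (t + 1)) - b = (1 - 1 / a (t + 1)) • (K (x t) - b)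
        + (1 / a (t + 1)) • (K (z (t + 1)) - b) := by
      rw [h.x_step, map_add, map_smul, map_smul]
      module
    have h2 : ConvexOn ℝ Set.univ (fun w : U => ‖w‖ ^ 2) :=
      convexOn_univ_norm.pow (fun _ _ => norm_nonneg _) 2
    have := h2.2 (Set.mem_univ (K (x t) - b)) (Set.mem_univ (K (z (t + 1)) - b)) hθ
      (by positivity) (sub_add_cancel 1 (1 / a (t + 1)))
    rw [h1]
    simpa using this
  have h3 := mul_le_mul_of_nonneg_left hconv (show 0 ≤ a (t + 1) * τ / 2 by positivity)
  have e : a (t + 1) * τ / 2 * ((1 - 1 / a (t + 1)) * ‖K (x t) - b‖ ^ 2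
      + 1 / a (t + 1) * ‖K (z (t + 1)) - b‖ ^ 2)
      = (a (t + 1) - 1) * (τ / 2 * ‖K (x t) - b‖ ^ 2) + τ / 2 * ‖K (z (t + 1)) - b‖ ^ 2 := by
    field_simp
  have h4 : a (t + 1) - 1 ≤ a t := by nlinarith [h.primal_growth t, h.one_le t]
  have h5 := mul_le_mul_of_nonneg_right h4 (show 0 ≤ τ / 2 * ‖K (x t) - b‖ ^ 2 by positivity)
  linarith

theorem le_lyapunov (h : ConstrainedRun f L K b γ τ a x y z v)
    (hp : gradient f p + K.adjoint us = 0) (hpb : K p = b) (t : ℕ) :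
    1 / (2 * γ) * ‖z t - p‖ ^ 2 + a t ^ 2 * bregman f p (x t)
      + a t * (min (1 / 2) (1 / (2 * γ * L)) * γ * lambdaMinPos K / 4) * ‖v t - us‖ ^ 2
      + a t * τ / 2 * ‖K (x t) - b‖ ^ 2
      ≤ lyapunov f L K (conjugate (indicatorPoint b)) b γ τ a x z u v p us t := by
  rw [lyapunov_eq hp hpb]
  linarith [h.le_dualEnergy us t]

/-- Each nonnegative part of the Lyapunov function is bounded by the initial value of the whole. -/
theorem bounds (h : ConstrainedRun f L K b γ τ a x y z v)
    (hp : gradient f p + K.adjoint us = 0) (hus : us ∈ Set.range K) (hpb : K p = b) :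
    ∃ C : ℝ, 0 ≤ C ∧ ∀ t, ‖z t - p‖ ^ 2 ≤ C ∧ a t ^ 2 * bregman f p (x t) ≤ C ∧
      a t * ‖v t - us‖ ^ 2 ≤ C ∧ a t * ‖K (x t) - b‖ ^ 2 ≤ C := by
  have hγ := h.γ_pos
  have hτ := h.τ_pos
  have hL := h.L_pos
  have hlam := h.lam_pos
  set M := lyapunov f L K (conjugate (indicatorPoint b)) b γ τ a x z v v p us 0 with hM
  set c := min (1 / 2) (1 / (2 * γ * L)) * γ * lambdaMinPos K / 4 with hc
  have hc0 : 0 < c := by positivity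
  have hall : ∀ t, 1 / (2 * γ) * ‖z t - p‖ ^ 2 + a t ^ 2 * bregman f p (x t)
      + a t * c * ‖v t - us‖ ^ 2 + a t * τ / 2 * ‖K (x t) - b‖ ^ 2 ≤ M := fun t =>
    (h.le_lyapunov hp hpb t).trans (h.lyapunov_antitone hp hus hpb (Nat.zero_le t))
  have hnn : ∀ t, 0 ≤ 1 / (2 * γ) * ‖z t - p‖ ^ 2 ∧ 0 ≤ a t ^ 2 * bregman f p (x t) ∧
      0 ≤ a t * c * ‖v t - us‖ ^ 2 ∧ 0 ≤ a t * τ / 2 * ‖K (x t) - b‖ ^ 2 := by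
    intro t
    have ha : 0 < a t := by linarith [h.one_le t]
    have := bregman_nonneg h.convex h.differentiable p (x t)
    refine ⟨?_, ?_, ?_, ?_⟩ <;> positivity
  have hM0 : 0 ≤ M := by
    have := hall 0
    have := hnn 0
    linarith
  refine ⟨M * (2 * γ + 1 + 1 / c + 2 / τ), by positivity, fun t => ?_⟩
  obtain ⟨h1, h2, h3, h4⟩ := hnn t
  have h5 := hall t
  have k1 : 0 ≤ M * (2 * γ) := by positivity
  have k2 : 0 ≤ M * (1 / c) := by positivity
  have k3 : 0 ≤ M * (2 / τ) := by positivity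
  refine ⟨?_, ?_, ?_, ?_⟩
  · have : 1 / (2 * γ) * ‖z t - p‖ ^ 2 ≤ M := by linarith
    rw [one_div, inv_mul_le_iff₀ (by positivity)] at this
    linarith
  · linarith
  · have : c * (a t * ‖v t - us‖ ^ 2) ≤ M := by linarith
    rw [← le_div_iff₀' hc0, div_eq_mul_one_div] at this
    linarith
  · have : τ / 2 * (a t * ‖K (x t) - b‖ ^ 2) ≤ M := by linarith
    rw [← le_div_iff₀' (by positivity), div_eq_mul_one_div, one_div_div] at this
    linarith

theorem tendsto_norm_K_z_sub (h : ConstrainedRun f L K b γ τ a x y z v)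
    (hp : gradient f p + K.adjoint us = 0) (hus : us ∈ Set.range K) (hpb : K p = b) :
    Tendsto (fun t => ‖K (z t) - b‖) atTop (𝓝 0) := by
  have hγ := h.γ_pos
  have hτ := h.τ_pos
  have hL := h.L_pos
  have hlam := h.lam_pos
  have h1 : Tendsto (fun t => τ / 2 * ‖K (z t) - b‖ ^ 2) atTop (𝓝 0) := by
    refine tendsto_zero_of_descent (Ψ := fun t =>
      lyapunov f L K (conjugate (indicatorPoint b)) b γ τ a x z v v p us t
        - a t * τ / 2 * ‖K (x t) - b‖ ^ 2) (fun t => ?_) (fun t => by positivity)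
      (fun t => h.lyapunov_descent hp hus hpb t)
    have ha : 0 < a t := by linarith [h.one_le t]
    have hb := bregman_nonneg h.convex h.differentiable p (x t)
    have h2 := h.le_lyapunov (u := v) hp hpb t
    have : 0 ≤ 1 / (2 * γ) * ‖z t - p‖ ^ 2 + a t ^ 2 * bregman f p (x t)
      + a t * (min (1 / 2) (1 / (2 * γ * L)) * γ * lambdaMinPos K / 4) * ‖v t - us‖ ^ 2 := by
      positivity
    linarith
  have h2 := (h1.const_mul (2 / τ)).sqrt
  rw [mul_zero, Real.sqrt_zero] at h2
  refine h2.congr fun t => ?_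
  rw [← mul_assoc, div_mul_div_comm, mul_comm 2 τ, div_self (by positivity), one_mul,
    Real.sqrt_sq (norm_nonneg _)]

/-! ### Weak convergence -/

theorem exists_norm_le (h : ConstrainedRun f L K b γ τ a x y z v)
    (hp : gradient f p + K.adjoint us = 0) (hus : us ∈ Set.range K) (hpb : K p = b) :
    ∃ M : ℝ, (∀ t, ‖z t‖ ≤ M) ∧ ∀ t, ‖x t‖ ≤ M := by
  obtain ⟨C, hC0, hC⟩ := h.bounds hp hus hpb
  have hz : ∀ t, ‖z t‖ ≤ √C + ‖p‖ := by
    intro t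
    have h1 : ‖z t - p‖ ≤ √C := Real.le_sqrt_of_sq_le (hC t).1
    have h2 : ‖z t‖ ≤ ‖z t - p‖ + ‖p‖ := by simpa using norm_add_le (z t - p) p
    linarith
  refine ⟨_, hz, fun t => ?_⟩
  induction t with
  | zero => rw [h.init]; exact hz 0
  | succ t ih =>
    have hA : 0 < a (t + 1) := by linarith [h.one_le (t + 1)]
    have hθ : 0 ≤ 1 - 1 / a (t + 1) := by
      rw [sub_nonneg, div_le_one hA]
      exact h.one_le _
    rw [h.x_step]
    refine mem_closedBall_zero_iff.1 (convex_closedBall (0 : X) _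
      (mem_closedBall_zero_iff.2 ih) (mem_closedBall_zero_iff.2 (hz (t + 1))) hθ
      (by positivity) (sub_add_cancel 1 _))

/-- Inner products of `z` with differences of two solutions converge: the Lyapunov functions of
the two solutions differ by an affine function of this inner product. -/
theorem exists_tendsto_inner_z (h : ConstrainedRun f L K b γ τ a x y z v) {p' : X}
    (hp : gradient f p + K.adjoint us = 0) (hus : us ∈ Set.range K) (hpb : K p = b)
    (hp' : gradient f p' + K.adjoint us = 0) (hpb' : K p' = b) :
    ∃ l : ℝ, Tendsto (fun t => inner ℝ (z t) (p - p')) atTop (𝓝 l) := by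
  have hγ := h.γ_pos
  have hconv : ∀ p, gradient f p + K.adjoint us = 0 → K p = b → ∃ l : ℝ, Tendsto
      (lyapunov f L K (conjugate (indicatorPoint b)) b γ τ a x z v v p us) atTop (𝓝 l) := by
    intro p hp hpb
    refine ⟨_, tendsto_atTop_ciInf (h.lyapunov_antitone hp hus hpb) ⟨0, ?_⟩⟩
    rintro _ ⟨t, rfl⟩
    have ha : 0 < a t := by linarith [h.one_le t]
    have hb := bregman_nonneg h.convex h.differentiable p (x t)
    have hd := h.dualEnergy_nonneg us t
    rw [lyapunov_eq hp hpb]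
    positivity
  obtain ⟨l, hl⟩ := hconv p hp hpb
  obtain ⟨l', hl'⟩ := hconv p' hp' hpb'
  have hbr := (gradient_eq_and_bregman_eq h.convex h.differentiable h.L_pos h.smooth hp hpb
    hp' hpb').2
  refine ⟨_, (((hl.sub hl').const_mul γ).const_sub ((‖p‖ ^ 2 - ‖p'‖ ^ 2) / 2)).congr fun t => ?_⟩
  rw [lyapunov_eq hp hpb, lyapunov_eq hp' hpb', hbr, norm_sub_sq_real, norm_sub_sq_real,
    inner_sub_right]
  field_simp
  ring

theorem exists_weak_limit (h : ConstrainedRun f L K b γ τ a x y z v)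
    (hp : gradient f p + K.adjoint us = 0) (hus : us ∈ Set.range K) (hpb : K p = b)
    (hatop : Tendsto a atTop atTop)
    (hsum : Tendsto (fun T : ℕ => ∑ t ∈ Finset.range T, 1 / a (t + 1)) atTop atTop) :
    ∃ q : X, IsPrimalSolution f 0 K b q ∧
      Tendsto (fun t : ℕ => toWeakSpace ℝ X (x t)) atTop (𝓝 (toWeakSpace ℝ X q)) ∧
      Tendsto (fun t : ℕ => toWeakSpace ℝ X (y t)) atTop (𝓝 (toWeakSpace ℝ X q)) := by
  obtain ⟨C, hC0, hC⟩ := h.bounds hp hus hpb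
  obtain ⟨M, hzM, hxM⟩ := h.exists_norm_le hp hus hpb
  have hinv : Tendsto (fun t => C / a t) atTop (𝓝 0) := hatop.const_div_atTop C
  have hapos : ∀ t, 0 < a t := fun t => by linarith [h.one_le t]
  have hbr : Tendsto (fun t => bregman f p (x t)) atTop (𝓝 0) := by
    refine squeeze_zero (fun t => bregman_nonneg h.convex h.differentiable _ _) (fun t => ?_) hinv
    have hb := bregman_nonneg h.convex h.differentiable p (x t)
    rw [le_div_iff₀ (hapos t)]
    have := mul_le_mul_of_nonneg_right (h.one_le t) (mul_nonneg (hapos t).le hb)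
    linarith [(hC t).2.1]
  have hKx : Tendsto (fun t => K (x t)) atTop (𝓝 b) := by
    rw [tendsto_iff_norm_sub_tendsto_zero]
    have h1 : Tendsto (fun t => ‖K (x t) - b‖ ^ 2) atTop (𝓝 0) := by
      refine squeeze_zero (fun t => sq_nonneg _) (fun t => ?_) hinv
      rw [le_div_iff₀ (hapos t)]
      linarith [(hC t).2.2.2]
    have h2 := h1.sqrt
    rw [Real.sqrt_zero] at h2
    exact h2.congr fun t => Real.sqrt_sq (norm_nonneg _)
  let S : Set X := {q | gradient f q + K.adjoint us = 0 ∧ K q = b}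
  have hclus : ∀ (F : Ultrafilter ℕ) (q : X), (F : Filter ℕ) ≤ atTop →
      (∀ w : X, Tendsto (fun t => inner ℝ (x t) w) F (𝓝 (inner ℝ q w))) → q ∈ S := by
    intro F q hF hq
    have hqb : K q = b := by
      refine ext_inner_right ℝ fun w => ?_
      have h1 : Tendsto (fun t => inner ℝ (K (x t)) w) F (𝓝 (inner ℝ b w)) :=
        (hKx.mono_left hF).inner tendsto_const_nhds
      have h2 := hq (K.adjoint w)
      simp only [ContinuousLinearMap.adjoint_inner_right] at h2
      exact tendsto_nhds_unique h2 h1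
    -- the affine minorant at `q` passes to the weak limit
    have hle : bregman f p q ≤ 0 := by
      have h1 := (hq (gradient f q - gradient f p)).sub_const
        (inner ℝ q (gradient f q - gradient f p))
      rw [sub_self] at h1
      have h2 := (hbr.mono_left hF).sub h1
      rw [sub_zero] at h2
      refine ge_of_tendsto' h2 fun t => ?_
      have h3 := add_inner_gradient_le h.convex h.differentiable q (x t)
      have e : x t - p = (x t - q) + (q - p) := by abel
      rw [← inner_sub_left, inner_sub_right _ (gradient f q), bregman, bregman, e, inner_add_right,
        real_inner_comm _ (x t - q), real_inner_comm _ (x t - q)]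
      linarith
    have h1 := add_inner_gradient_add_sq_le h.convex h.differentiable h.L_pos h.smooth p q
    have h2 : ‖gradient f q - gradient f p‖ ^ 2 = 0 := by
      have hL := h.L_pos
      have hc0 : 0 < 1 / (2 * L) := by positivity
      by_contra hne
      have := mul_pos hc0 (lt_of_le_of_ne (sq_nonneg _) (Ne.symm hne))
      unfold bregman at hle
      linarith
    have hg : gradient f q = gradient f p :=
      sub_eq_zero.1 (norm_eq_zero.1 (pow_eq_zero_iff two_ne_zero |>.1 h2))
    exact ⟨by rw [hg]; exact hp, hqb⟩
  have hdiff : ∀ q ∈ S, ∀ q' ∈ S,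
      ∃ l : ℝ, Tendsto (fun t => inner ℝ (x t) (q - q')) atTop (𝓝 l) := by
    rintro q ⟨hq, hqb⟩ q' ⟨hq', hqb'⟩
    obtain ⟨l, hl⟩ := h.exists_tendsto_inner_z hq hus hqb hq' hqb'
    refine ⟨l, tendsto_of_averaging (θ := fun t => 1 / a (t + 1))
      (fun t => one_div_nonneg.2 (hapos _).le) (fun t => ?_) hsum (fun t => ?_)
      ((tendsto_add_atTop_iff_nat 1).2 hl)⟩
    · rw [div_le_one (hapos _)]
      exact h.one_le _
    · rw [h.x_step, inner_add_left, inner_smul_left, inner_smul_left]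
      simp only [conj_trivial]
  obtain ⟨q, ⟨hq, hqb⟩, hlim⟩ := exists_tendsto_weak_of_cluster_mem hxM hclus hdiff
  refine ⟨q, ⟨hqb, fun x' hx' => ?_⟩, tendsto_toWeakSpace_iff.2 hlim,
    tendsto_toWeakSpace_iff.2 fun w => ?_⟩
  · have h1 := add_inner_gradient_le h.convex h.differentiable q x'
    rw [eq_neg_of_add_eq_zero_left hq, inner_neg_left, ContinuousLinearMap.adjoint_inner_left,
      map_sub, hqb, hx', sub_self, inner_zero_right] at h1
    simpa using h1
  ·
    -- `x (t + 1) - y t = (z (t + 1) - z t) / a (t + 1)` tends to zero in norm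
    have hsmall : Tendsto (fun t => inner ℝ ((1 / a (t + 1)) • (z (t + 1) - z t)) w) atTop
        (𝓝 0) := by
      have h0 : Tendsto (fun t => 2 * M * ‖w‖ / a (t + 1)) atTop (𝓝 0) :=
        ((tendsto_add_atTop_iff_nat 1).2 hatop).const_div_atTop _
      refine squeeze_zero_norm (fun t => ?_) h0
      refine (norm_inner_le_norm _ _).trans ?_
      rw [norm_smul, Real.norm_of_nonneg (one_div_nonneg.2 (hapos _).le)]
      have h2 : ‖z (t + 1) - z t‖ ≤ 2 * M := by
        linarith [norm_sub_le (z (t + 1)) (z t), hzM t, hzM (t + 1)]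
      calc 1 / a (t + 1) * ‖z (t + 1) - z t‖ * ‖w‖
          ≤ 1 / a (t + 1) * (2 * M) * ‖w‖ := by
            have := (hapos (t + 1)).le
            gcongr
        _ = 2 * M * ‖w‖ / a (t + 1) := by ring
    have h3 := ((tendsto_add_atTop_iff_nat 1).2 (hlim w)).sub hsmall
    rw [sub_zero] at h3
    refine h3.congr fun t => ?_
    rw [← inner_sub_left, h.x_step, h.y_step]
    congr 1
    module

end ConstrainedRun

end Run

/-! ### From the algorithm to a constrained run -/

section Reduction

variable {X U : Type*} [NormedAddCommGroup X] [InnerProductSpace ℝ X] [CompleteSpace X]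
  [NormedAddCommGroup U] [InnerProductSpace ℝ U] [CompleteSpace U]
  {f : X → ℝ} {K : X →L[ℝ] U} {b : U} {γ τ : ℝ} {a : ℕ → ℝ} {x y z zh : ℕ → X} {u v : ℕ → U}

theorem IsAPAPC.dual_step_eq (h : IsAPAPC f 0 K (conjugate (indicatorPoint b)) γ τ a x y z zh u v)
    (t : ℕ) : v (t + 1) = v t + (τ / a (t + 1)) • (K (zh t) - b) := by
  rw [(h.dual_step t).eq_sub_smul]
  module

theorem IsAPAPC.predict_eq (h : IsAPAPC f 0 K (conjugate (indicatorPoint b)) γ τ a x y z zh u v)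
    (t : ℕ) : zh t = z (t + 1) + (a (t + 1) * γ) • K.adjoint (v (t + 1) - v t) := by
  rw [h.predict, h.correct, map_sub]
  simp only [mul_zero, add_zero, inv_one, one_smul]
  module

/-- The three bounds in the recursion for `a` supply the growth conditions of `ConstrainedRun`. -/
theorem IsAPAPC.constrainedRun
    (h : IsAPAPC f 0 K (conjugate (indicatorPoint b)) γ τ a x y z zh u v)
    (hf_conv : ConvexOn ℝ Set.univ f) (hf_diff : Differentiable ℝ f) {L : ℝ} (hL : 0 < L)
    (hf_smooth : ∀ p q : X, ‖gradient f p - gradient f q‖ ≤ L * ‖p - q‖)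
    (hlam : 0 < lambdaMinPos K) (hb : b ∈ Set.range K) (hγ : 0 < γ) (hγL : γ ≤ 1 / (2 * L))
    (hτ : 0 < τ) (hγτ : γ * τ * ‖K‖ ^ 2 ≤ 1)
    (ha : ∀ t, 1 ≤ a t ∧ a t ≤ a (t + 1) ∧ a (t + 1) ^ 2 - a (t + 1) ≤ a t ^ 2 ∧
      a (t + 1) ^ 2 ≤ a t ^ 2 * (1 + γ * τ * lambdaMinPos K / 4) ∧
      a (t + 1) ^ 2 ≤ a t ^ 2 + a t * (τ * lambdaMinPos K / (4 * L)))
    (hv0 : v 0 ∈ Set.range K) :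
    ConstrainedRun f L K b γ τ a x y z v where
  convex := hf_conv
  differentiable := hf_diff
  L_pos := hL
  smooth := hf_smooth
  γ_pos := hγ
  γ_le := hγL
  τ_pos := hτ
  stepsize := hγτ
  lam_pos := hlam
  one_le t := (ha t).1
  mono t := (ha t).2.1
  primal_growth t := (ha t).2.2.1
  dual_growth t := by
    obtain ⟨h1, -, -, h2, h3⟩ := ha t
    have h0 : 0 < a t := by linarith
    rcases min_choice (1 / 2 : ℝ) (1 / (2 * a t * γ * L)) with hm | hm
    · rw [hm]
      refine h2.trans_eq ?_
      ring
    · rw [hm]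
      refine h3.trans_eq ?_
      field_simp
      ring
  init := h.init_primal
  v_mem t := by
    induction t with
    | zero => exact hv0
    | succ t ih =>
      obtain ⟨p, hp⟩ := ih
      obtain ⟨q, hq⟩ := hb
      refine ⟨p + (τ / a (t + 1)) • (zh t - q), ?_⟩
      rw [h.dual_step_eq, map_add, map_smul, map_sub, hp, hq]
  y_step := h.y_step
  v_step t := by
    have h1 := h.dual_step_eq t
    rwa [h.predict_eq, map_add, map_smul] at h1
  z_step t := by
    have h1 := h.correct t
    simpa only [mul_zero, add_zero, inv_one, one_smul] using h1
  x_step := h.x_step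

end Reduction

end APAPC

theorem mainTheorem8 {X U : Type*}
    [NormedAddCommGroup X] [InnerProductSpace ℝ X] [CompleteSpace X]
    [NormedAddCommGroup U] [InnerProductSpace ℝ U] [CompleteSpace U]
    (f : X → ℝ) (hf_conv : ConvexOn ℝ Set.univ f) (hf_diff : Differentiable ℝ f)
    (L : ℝ) (hL : 0 < L) (hf_smooth : ∀ p q : X, ‖gradient f p - gradient f q‖ ≤ L * ‖p - q‖)
    (K : X →L[ℝ] U) (hK : K ≠ 0) (hlam : 0 < lambdaMinPos K)
    (b : U) (hb : b ∈ Set.range K)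
    -- the function `h*`, conjugate of the indicator function of `{b}`
    (hc : U → EReal) (hhc : hc = conjugate (indicatorPoint b))
    -- a solution of the optimality system
    (xs : X) (us : U) (hsol : IsConstrainedSolution f 0 K b xs us)
    -- stepsizes and parameters
    (γ τ ν : ℝ) (hγ : 0 < γ) (hγL : γ ≤ 1 / (2 * L)) (hν : ν ∈ Set.Ioc (0 : ℝ) 1)
    (hτ : τ = ν / (γ * ‖K‖ ^ 2))
    (a : ℕ → ℝ) (ha0 : a 0 = 1) (ha1 : a 1 = 1)
    (ha : ∀ t : ℕ, 1 ≤ t → a (t + 1) =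
      min (a t * √(1 + ν * lambdaMinPos K / (4 * ‖K‖ ^ 2)))
        (min (√(a t ^ 2 + a t * (ν * lambdaMinPos K / (4 * γ * L * ‖K‖ ^ 2))))
          ((1 + √(1 + 4 * a t ^ 2)) / 2)))
    -- the iterates of the algorithm with `μ = 0`
    (x y z zh : ℕ → X) (u v : ℕ → U)
    (halg : IsAPAPC f 0 K hc γ τ a x y z zh u v) (hv0 : v 0 ∈ Set.range K)
    (s : ℕ → U) (hs : IsProxSubgradient K τ a zh v s) :
    -- the Lyapunov function is nonincreasing, and the resulting rates
    Antitone (lyapunov f L K hc b γ τ a x z u v xs us) ∧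
    (fun t : ℕ => gap f 0 K hc xs us (x t) (u t)) =O[atTop] (fun t : ℕ => 1 / (t : ℝ) ^ 2) ∧
    a =Θ[atTop] (fun t : ℕ => (t : ℝ)) ∧
    (fun t : ℕ => ‖v t - us‖ ^ 2) =O[atTop] (fun t : ℕ => 1 / (t : ℝ)) ∧
    -- the selected subgradients of `h*` are subgradients and all equal `b`
    (∀ t : ℕ, s (t + 1) ∈ subdifferential hc (v (t + 1)) ∧ s (t + 1) = b) ∧
    Tendsto (fun t : ℕ => ‖K (z t) - b‖) atTop (𝓝 0) ∧
    -- (i)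
    (Tendsto a atTop atTop ∧
      Tendsto (fun T : ℕ => ∑ t ∈ Finset.Icc 1 T, 1 / a t) atTop atTop) ∧
    -- (ii), the dual problem being considered on the range of `K`
    ((∀ w ∈ Set.range K, IsDualSolution f 0 K hc w ↔ w = us) ∧
      Tendsto (fun t : ℕ => ‖v t - us‖) atTop (𝓝 0)) ∧
    -- (iii)
    Bornology.IsBounded (Set.range z) ∧
    -- (iv)
    (∀ (x' : X) (u' : U), IsSaddlePoint f 0 K hc x' u' →
      Tendsto (fun t : ℕ => gap f 0 K hc x' u' (x t) (u t)) atTop (𝓝 0)) ∧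
    -- (v)
    Tendsto (fun t : ℕ => ‖K (z t) - s t‖) atTop (𝓝 0) ∧
    -- (vi)
    (∃ R : ℕ → ℝ, (∀ t, 0 ≤ R t) ∧
      ∀ (x' : X) (u' : U), IsSaddlePoint f 0 K hc x' u' →
        Antitone (fun t : ℕ => 1 / (2 * γ) * ‖z t - x'‖ ^ 2
          + a t ^ 2 * gap f 0 K hc x' u' (x t) (u t) + R t)) ∧
    -- (vii)
    (∀ (x₁ x₂ : X) (u' : U), IsSaddlePoint f 0 K hc x₁ u' → IsSaddlePoint f 0 K hc x₂ u' →
      K x₁ = K x₂) ∧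
    -- weak convergence to a primal solution
    ∃ xinf : X, IsPrimalSolution f 0 K b xinf ∧
      Tendsto (fun t : ℕ => toWeakSpace ℝ X (x t)) atTop (𝓝 (toWeakSpace ℝ X xinf)) ∧
      Tendsto (fun t : ℕ => toWeakSpace ℝ X (y t)) atTop (𝓝 (toWeakSpace ℝ X xinf)) := by
  subst hhc
  obtain ⟨hp, hus, hpb⟩ := isConstrainedSolution_iff.1 hsol
  obtain ⟨hν0, hν1⟩ := hν
  have hKpos : 0 < ‖K‖ := norm_pos_iff.2 hK
  have hτ0 : 0 < τ := by rw [hτ]; positivity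
  have hγτ : γ * τ * ‖K‖ ^ 2 = ν := by rw [hτ]; field_simp
  -- the constants of the recursion in terms of `τ`
  have hκ : ν * lambdaMinPos K / (4 * ‖K‖ ^ 2) = γ * τ * lambdaMinPos K / 4 := by
    rw [← hγτ]; field_simp
  have hc : ν * lambdaMinPos K / (4 * γ * L * ‖K‖ ^ 2) = τ * lambdaMinPos K / (4 * L) := by
    rw [← hγτ]; field_simp
  rw [hκ, hc] at ha
  have hκ0 : 0 < γ * τ * lambdaMinPos K / 4 := by positivity
  have hc0 : 0 < τ * lambdaMinPos K / (4 * L) := by positivity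
  have hpar := one_le_and_step_of_recursion hκ0.le hc0.le ha0 ha1 ha
  have hrun : ConstrainedRun f L K b γ τ a x y z v :=
    halg.constrainedRun hf_conv hf_diff hL hf_smooth hlam hb hγ hγL hτ0 (hγτ.trans_le hν1) hpar hv0
  have hone := hrun.one_le
  have hapos : ∀ t, 0 < a t := fun t => by linarith [hone t]
  obtain ⟨d, hd, hinc⟩ := exists_add_le_of_recursion hκ0 hc0 hone ha
  obtain ⟨hΘ, hale⟩ := isTheta_natCast_of_increments hd hone ha0 ha1 hinc hrun.primal_growth
  have hatop : Tendsto a atTop atTop := by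
    have h1 : Tendsto (norm ∘ a) atTop atTop :=
      hΘ.tendsto_norm_atTop_iff.2 (tendsto_norm_atTop_atTop.comp tendsto_natCast_atTop_atTop)
    exact h1.congr fun t => Real.norm_of_nonneg (hapos t).le
  have hsum := tendsto_sum_one_div_atTop hone hale
  obtain ⟨C, hC0, hC⟩ := hrun.bounds hp hus hpb
  have hdiv : Tendsto (fun t => C / a t) atTop (𝓝 0) := hatop.const_div_atTop C
  have hs_eq : ∀ t, s (t + 1) = b := by
    intro t
    have h1 := hs t
    rw [halg.dual_step_eq, add_assoc, add_left_cancel_iff, ← smul_add, sub_add_eq_add_sub] at h1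
    have h2 := smul_right_injective U (div_pos hτ0 (hapos (t + 1))).ne' h1
    exact add_left_cancel (sub_eq_iff_eq_add.1 h2)
  have hbnn := bregman_nonneg hf_conv hf_diff xs
  have hgap0 : (fun t : ℕ => bregman f xs (x t)) =O[atTop] (fun t : ℕ => 1 / (t : ℝ) ^ 2) := by
    have h1 : (fun t : ℕ => bregman f xs (x t)) =O[atTop] (fun t : ℕ => 1 / a t ^ 2) := by
      refine IsBigO.of_bound C (Eventually.of_forall fun t => ?_)
      have := hapos t
      rw [Real.norm_of_nonneg (hbnn _), Real.norm_of_nonneg (by positivity), mul_one_div,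
        le_div_iff₀ (by positivity)]
      linarith [(hC t).2.1]
    exact h1.trans (by simpa only [one_div] using (hΘ.pow 2).inv.isBigO)
  have hgap_tendsto : Tendsto (fun t : ℕ => bregman f xs (x t)) atTop (𝓝 0) := by
    refine hgap0.trans_tendsto ?_
    simpa using (tendsto_inv_atTop_nhds_zero_nat (𝕜 := ℝ)).pow 2
  have hKz := hrun.tendsto_norm_K_z_sub hp hus hpb
  have hvs : Tendsto (fun t => ‖v t - us‖) atTop (𝓝 0) := by
    have h1 : Tendsto (fun t => ‖v t - us‖ ^ 2) atTop (𝓝 0) := by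
      refine squeeze_zero (fun t => sq_nonneg _) (fun t => ?_) hdiv
      rw [le_div_iff₀ (hapos t)]
      linarith [(hC t).2.2.1]
    have h2 := h1.sqrt
    rw [Real.sqrt_zero] at h2
    exact h2.congr fun t => Real.sqrt_sq (norm_nonneg _)
  -- a saddle point with any dual variable has the gradient of `f` at `xs`
  have hsaddle : ∀ (x' : X) (u' : U),
      IsSaddlePoint f 0 K (conjugate (indicatorPoint b)) x' u' →
      gradient f x' + K.adjoint us = 0 ∧ K x' = b ∧
      ∀ t, gap f 0 K (conjugate (indicatorPoint b)) x' u' (x t) (u t) = bregman f xs (x t) ∧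
        bregman f x' (x t) = bregman f xs (x t) := by
    intro x' u' h'
    obtain ⟨hp', hpb'⟩ := isSaddlePoint_iff.1 h'
    obtain ⟨hg, hbr⟩ := gradient_eq_and_bregman_eq hf_conv hf_diff hL hf_smooth hp hpb hp' hpb'
    refine ⟨by rw [hg]; exact hp, hpb', fun t => ⟨?_, hbr _⟩⟩
    rw [gap_eq_bregman hp' hpb', hbr]
  refine ⟨hrun.lyapunov_antitone hp hus hpb, ?_, hΘ, ?_, fun t => ⟨?_, hs_eq t⟩, hKz,
    ⟨hatop, ?_⟩, ⟨fun w hw => isDualSolution_iff_eq hf_conv hf_diff hlam hp hus hpb hw, hvs⟩, ?_,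
    ?_, ?_, ⟨dualEnergy L K b γ τ a x v us, hrun.dualEnergy_nonneg us, ?_⟩, ?_,
    hrun.exists_weak_limit hp hus hpb hatop hsum⟩
  · simpa only [gap_eq_bregman hp hpb] using hgap0
  · have h1 : (fun t : ℕ => ‖v t - us‖ ^ 2) =O[atTop] (fun t : ℕ => 1 / a t) := by
      refine IsBigO.of_bound C (Eventually.of_forall fun t => ?_)
      rw [Real.norm_of_nonneg (sq_nonneg _), Real.norm_of_nonneg (one_div_nonneg.2 (hapos t).le),
        mul_one_div, le_div_iff₀ (hapos t)]
      linarith [(hC t).2.2.1]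
    exact h1.trans (by simpa only [one_div] using hΘ.inv.isBigO)
  · exact mem_subdifferential_conjugate_indicatorPoint.2 (hs_eq t)
  · refine hsum.congr fun T => ?_
    induction T with
    | zero => simp
    | succ T ih => rw [Finset.sum_range_succ, ih, Finset.sum_Icc_succ_top (by omega)]
  · obtain ⟨M, hM, -⟩ := hrun.exists_norm_le hp hus hpb
    refine isBounded_iff_forall_norm_le.2 ⟨M, ?_⟩
    rintro _ ⟨t, rfl⟩
    exact hM t
  · intro x' u' h'
    exact hgap_tendsto.congr fun t => ((hsaddle x' u' h').2.2 t).1.symm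
  · -- `s 0` is unconstrained, all later subgradients equal `b`
    refine hKz.congr' ?_
    filter_upwards [eventually_ge_atTop 1] with t ht
    obtain ⟨t, rfl⟩ := Nat.exists_eq_add_of_le' ht
    rw [hs_eq]
  · intro x' u' h'
    obtain ⟨hp', hpb', hbr⟩ := hsaddle x' u' h'
    have h1 := hrun.lyapunov_antitone (u := u) hp' hus hpb'
    convert h1 using 1
    funext t
    rw [ConstrainedRun.lyapunov_eq hp' hpb', (hbr t).1, (hbr t).2]
  · intro x₁ x₂ u' h₁ h₂
    rw [(isSaddlePoint_iff.1 h₁).2, (isSaddlePoint_iff.1 h₂).2]
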